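/- An embedding of a finite connected simple graph $G$ means a cellular embedding in a closed orientable surface, given combinatorially (Heffter--Edmonds) by a rotation system: a permutation $\Phi$ of the edge ends (ordered pairs of adjacent vertices) that acts as a single cycle on the edge ends at each vertex. Its faces are the cycles of $\Phi\circ\theta$, where $\theta$ exchanges the two ends of every edge; the length of a face is the number of edge ends in the cycle; and its genus $g$ is determined by $|V|-|E|+|F|=2-2g$. The embedding has minimum genus if no embedding of $G$ has smaller genus, and it is nearly triangular if at most one face has length different from $3$. Theorem. For every integer $s\ge 1$, the complete graph $K_{12s+8}$ has a nearly triangular minimum genus embedding in which exactly one face has length $5$ and all other faces have length $3$. -/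

import Mathlib

/-- A rotation system of a simple graph `G`: a permutation of the edge ends (darts) of `G` whose
cycles are exactly the sets of edge ends incident with a common vertex, i.e. a cyclic permutation
of the edge ends at each vertex.  The dart `(u, v)` is the end at `u` of the edge `uv`.

For a connected graph with at least one edge, rotation systems are the cellular embeddings in
closed oriented surfaces, up to orientation-preserving homeomorphism of pairs
(Heffter-Edmonds). -/
structure RotationSystem {V : Type*} (G : SimpleGraph V) where
  /-- the next edge end at the same vertex -/
  rot : Equiv.Perm G.Dart
  /-- the next edge end is incident with the same vertex -/
  fst_rot : ∀ d : G.Dart, (rot d).fst = d.fst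
  /-- the edge ends at a vertex form a single cycle -/
  sameCycle_of_fst_eq : ∀ d d' : G.Dart, d.fst = d'.fst → rot.SameCycle d d'

namespace RotationSystem

/-- The involution that exchanges the two ends of each edge. -/
def flip {V : Type*} (G : SimpleGraph V) : Equiv.Perm G.Dart :=
  Function.Involutive.toPerm SimpleGraph.Dart.symm SimpleGraph.Dart.symm_involutive

/-- The face-tracing permutation: first exchange the ends of the edge, then rotate. -/
def facePerm {V : Type*} {G : SimpleGraph V} (R : RotationSystem G) : Equiv.Perm G.Dart :=
  R.rot * flip G

/-- The faces of the embedding: the cycles (including the fixed points) of the face-tracing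
permutation. -/
def Face {V : Type*} {G : SimpleGraph V} (R : RotationSystem G) : Type _ :=
  Quotient (Equiv.Perm.SameCycle.setoid R.facePerm)

/-- The face whose boundary walk passes through the dart `d`. -/
def faceOf {V : Type*} {G : SimpleGraph V} (R : RotationSystem G) (d : G.Dart) : R.Face :=
  Quotient.mk (Equiv.Perm.SameCycle.setoid R.facePerm) d

/-- The length (number of sides, counted with multiplicity) of a face. -/
noncomputable def faceLength {V : Type*} {G : SimpleGraph V} (R : RotationSystem G)
    (f : R.Face) : ℕ :=
  Nat.card {d : G.Dart // R.faceOf d = f}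

/-- `R` is an embedding of the connected graph `G` in the closed orientable surface of genus `g`:
the Euler polyhedral equation `|V| - |E| + |F| = 2 - 2g` holds. -/
def HasGenus {V : Type*} {G : SimpleGraph V} (R : RotationSystem G) (g : ℕ) : Prop :=
  G.Connected ∧
    (Nat.card V : ℤ) - (Nat.card G.edgeSet : ℤ) + (Nat.card R.Face : ℤ) = 2 - 2 * (g : ℤ)

end RotationSystem

/-- The minimum genus of `G`: the smallest genus over all embeddings of `G`. -/
noncomputable def SimpleGraph.minimumGenus {V : Type*} (G : SimpleGraph V) : ℕ :=
  sInf {g : ℕ | ∃ R : RotationSystem G, R.HasGenus g}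

namespace RotationSystem

/-- `R` is a minimum genus embedding of `G`. -/
def IsMinimumGenus {V : Type*} {G : SimpleGraph V} (R : RotationSystem G) : Prop :=
  R.HasGenus G.minimumGenus

/-- At most one face is not a triangle. -/
def IsNearlyTriangular {V : Type*} {G : SimpleGraph V} (R : RotationSystem G) : Prop :=
  ∀ f f' : R.Face, R.faceLength f ≠ 3 → R.faceLength f' ≠ 3 → f = f'

/-- Exactly one face is not a triangle, and that face has length `k` (for `k > 3`): an embedding
of type `(k)`. -/
def IsOfSingleType {V : Type*} {G : SimpleGraph V} (R : RotationSystem G) (k : ℕ) : Prop :=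
  ∃ f : R.Face, R.faceLength f = k ∧ ∀ f' : R.Face, f' ≠ f → R.faceLength f' = 3

end RotationSystem

/-! Counting reduces the theorem to a construction. Put `n = 12 * s + 8`. In any embedding of `K_n`
every face has at least three sides, so `3 |F| ≤ n (n - 1)`. Since `n (n - 1)` is `2` modulo `3`,
one pentagon with triangles elsewhere gives the largest possible number of faces, hence the least
genus (`isMinimumGenus_of_singleType`). It remains to find a rotation with exactly these faces.
`IsPentagonalRotation` collects local conditions on a successor function that produce one
(`rotationSystem`, `isOfSingleType`).

For `s ≥ 2` the rotation comes from a current graph over `ℤ / (12 * s + 3)`. The vertices are the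
group elements and five vortex vertices `A`, `B`, `X 0`, `X 1`, `X 2`. The row of a group element
`u` is the translate by `u` of one cyclic sequence, the log, with the vortices inserted; the order
of the three `X i` depends on `u` modulo `3`. Ringel's rule for the log (`logNext_spec`) makes every
face a triangle (`baseNext_baseNext`), which triangulates a surface by `K_n` minus the ten edges
between vortices. These edges are added by a surgery on eleven vertices: ten triangles are replaced
by fifteen triangles and a pentagon, at the cost of two handles. That the faces fit together is a
finite check on tables.

The delicate point is that each row is still a single cycle. In units of `1/4 = 3 * s + 1` the
currents next to the vortices are fixed small integers, and the log falls into four arcs with ends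
independent of `s` (`logNext_segments`). The surgery changes a row only at a few small offsets, so
tracing a row amounts to joining a fixed number of arcs (`iff_of_links`). Cyclicity is expressed by
invariant predicates so that such tracing becomes a chain of equivalences.

For `s = 1` branches of the log collide, and an explicit rotation of `K_20` is checked by
evaluation. -/

namespace RotationSystem

/-! ### Faces of a rotation system and their lengths. -/

variable {V : Type*} {G : SimpleGraph V}

theorem faceOf_eq_faceOf_iff (R : RotationSystem G) (d d' : G.Dart) :
    R.faceOf d = R.faceOf d' ↔ R.facePerm.SameCycle d d' :=
  Quotient.eq (r := Equiv.Perm.SameCycle.setoid R.facePerm)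

theorem exists_faceOf_eq (R : RotationSystem G) (f : R.Face) : ∃ d, R.faceOf d = f :=
  Quotient.exists_rep f

theorem facePerm_apply_fst (R : RotationSystem G) (d : G.Dart) :
    (R.facePerm d).fst = d.snd :=
  R.fst_rot d.symm

theorem facePerm_apply_ne (R : RotationSystem G) (d : G.Dart) : R.facePerm d ≠ d := fun h =>
  d.adj.ne ((congrArg (fun e : G.Dart => e.fst) h).symm.trans (R.facePerm_apply_fst d))

/-- In a graph of minimum degree at least two, no face has length two. -/
theorem facePerm_apply_apply_ne (R : RotationSystem G)
    (hG : ∀ u v, G.Adj u v → ∃ w, G.Adj u w ∧ w ≠ v) (d : G.Dart) :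
    R.facePerm (R.facePerm d) ≠ d := by
  intro h
  have h1 : (R.facePerm d).snd = d.fst := by
    rw [← R.facePerm_apply_fst, h]
  -- A face of length two would make the rotation fix an edge end, so its vertex would have degree
  -- one.
  have h2 : R.rot d.symm = d.symm := by
    apply SimpleGraph.Dart.ext
    exact Prod.ext (R.facePerm_apply_fst d) h1
  obtain ⟨w, hw, hne⟩ := hG d.snd d.fst d.adj.symm
  have h3 := R.sameCycle_of_fst_eq d.symm ⟨(d.snd, w), hw⟩ rfl
  have h4 := h3.eq_of_left h2
  exact hne (congrArg (fun e : G.Dart => e.snd) h4).symm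

theorem three_le_faceLength [Finite V] (R : RotationSystem G)
    (hG : ∀ u v, G.Adj u v → ∃ w, G.Adj u w ∧ w ≠ v) (f : R.Face) : 3 ≤ R.faceLength f := by
  classical
  obtain ⟨d, rfl⟩ := R.exists_faceOf_eq f
  have hfin : Finite G.Dart := Finite.of_injective _ SimpleGraph.Dart.toProd_injective
  have hs : ({d, R.facePerm d, R.facePerm (R.facePerm d)} : Set G.Dart) ⊆
      {e | R.faceOf e = R.faceOf d} := by
    rintro e (rfl | rfl | rfl)
    · rfl
    · exact (R.faceOf_eq_faceOf_iff _ _).2 (Equiv.Perm.sameCycle_apply_left.2 (.refl _ _))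
    · exact (R.faceOf_eq_faceOf_iff _ _).2
        (Equiv.Perm.sameCycle_apply_left.2 (Equiv.Perm.sameCycle_apply_left.2 (.refl _ _)))
  have h3 : ({d, R.facePerm d, R.facePerm (R.facePerm d)} : Set G.Dart).ncard = 3 :=
    Set.ncard_eq_three.2 ⟨_, _, _, (R.facePerm_apply_ne d).symm,
      (R.facePerm_apply_apply_ne hG d).symm, (R.facePerm_apply_ne _).symm, rfl⟩
  rw [← h3]
  exact Set.ncard_le_ncard hs (Set.toFinite _)

/-- The face lengths add up to the number of edge ends. -/
theorem finsum_faceLength [Fintype G.Dart] (R : RotationSystem G) [Fintype R.Face] :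
    ∑ f, R.faceLength f = Fintype.card G.Dart := by
  classical
  rw [← Fintype.card_congr (Equiv.sigmaFiberEquiv R.faceOf), Fintype.card_sigma]
  exact Finset.sum_congr rfl fun f _ => Nat.card_eq_fintype_card

end RotationSystem

/-! ### Counting faces of complete graphs; the minimum genus. -/

open SimpleGraph

theorem natCard_edgeSet_completeGraph (n : ℕ) :
    2 * Nat.card (completeGraph (Fin n)).edgeSet = n * (n - 1) := by
  classical
  rw [Nat.card_eq_fintype_card, ← edgeFinset_card, card_edgeFinset_top_eq_card_choose_two,
    Fintype.card_fin, Nat.choose_two_right, Nat.mul_div_cancel' (Nat.even_mul_pred_self n).two_dvd]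

namespace RotationSystem

theorem finsum_faceLength_completeGraph {n : ℕ} (R : RotationSystem (completeGraph (Fin n)))
    [Fintype R.Face] : ∑ f, R.faceLength f = n * (n - 1) := by
  classical
  rw [R.finsum_faceLength, dart_card_eq_twice_card_edges, ← natCard_edgeSet_completeGraph n,
    Nat.card_eq_fintype_card, ← edgeFinset_card]

instance finite_face {V : Type*} [Finite V] {G : SimpleGraph V} (R : RotationSystem G) :
    Finite R.Face :=
  have : Finite G.Dart := Finite.of_injective _ SimpleGraph.Dart.toProd_injective
  Finite.of_surjective R.faceOf R.exists_faceOf_eq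

theorem three_mul_card_face_le {n : ℕ} (hn : 3 ≤ n) (R : RotationSystem (completeGraph (Fin n))) :
    3 * Nat.card R.Face ≤ n * (n - 1) := by
  classical
  have : Fintype R.Face := Fintype.ofFinite _
  rw [← R.finsum_faceLength_completeGraph, Nat.card_eq_fintype_card, mul_comm]
  refine Finset.card_nsmul_le_sum _ _ _ fun f _ => R.three_le_faceLength (fun u v _ => ?_) f
  obtain ⟨w, hw⟩ := Finset.exists_mem_notMem_of_card_lt_card
    (s := {u, v}) (t := (Finset.univ : Finset (Fin n)))
    (by rw [Finset.card_univ, Fintype.card_fin]; exact Finset.card_le_two.trans_lt hn)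
  simp only [Finset.mem_insert, Finset.mem_singleton, not_or] at hw
  exact ⟨w, by simpa [eq_comm] using hw.2.1, hw.2.2⟩

theorem three_mul_card_face_of_singleType {n : ℕ} (R : RotationSystem (completeGraph (Fin n)))
    (h : R.IsOfSingleType 5) : 3 * Nat.card R.Face + 2 = n * (n - 1) := by
  classical
  have : Fintype R.Face := Fintype.ofFinite _
  obtain ⟨f, hf, h3⟩ := h
  have hs : ∑ g ∈ Finset.univ.erase f, R.faceLength g = (Finset.univ.erase f).card * 3 :=
    Finset.sum_const_nat fun g hg => h3 g (Finset.ne_of_mem_erase hg)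
  have hc := Finset.card_erase_add_one (Finset.mem_univ f)
  rw [← R.finsum_faceLength_completeGraph, ← Finset.sum_erase_add _ _ (Finset.mem_univ f), hs, hf,
    Nat.card_eq_fintype_card, ← Finset.card_univ]
  omega

theorem isNearlyTriangular_of_singleType {V : Type*} {G : SimpleGraph V} {k : ℕ}
    {R : RotationSystem G} (h : R.IsOfSingleType k) : R.IsNearlyTriangular := by
  obtain ⟨f, -, h3⟩ := h
  have key : ∀ g, R.faceLength g ≠ 3 → g = f := fun g hg => by_contra fun hne => hg (h3 g hne)
  exact fun g g' hg hg' => (key g hg).trans (key g' hg').symm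

/-- The pentagon wastes only two edge ends over a full triangulation, too few for another face;
Euler's formula turns this into minimality of the genus. -/
theorem isMinimumGenus_of_singleType {s : ℕ}
    (R : RotationSystem (completeGraph (Fin (12 * s + 8)))) (h : R.IsOfSingleType 5) :
    R.IsMinimumGenus := by
  have hE := natCard_edgeSet_completeGraph (12 * s + 8)
  have hF := R.three_mul_card_face_of_singleType h
  have hmul : (12 * s + 8) * (12 * s + 8 - 1) = 144 * s ^ 2 + 180 * s + 56 := by
    rw [show 12 * s + 8 - 1 = 12 * s + 7 from rfl]; ring
  rw [hmul] at hE hF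
  have hconn : (completeGraph (Fin (12 * s + 8))).Connected := connected_top
  -- This is `(n - 3)(n - 4) / 12` rounded up, for `n = 12 * s + 8`.
  have hR : R.HasGenus (12 * s ^ 2 + 9 * s + 2) := by
    refine ⟨hconn, ?_⟩
    rw [Nat.card_fin]
    zify at hE hF
    push_cast
    linarith
  have hleast : IsLeast {g : ℕ | ∃ R : RotationSystem (completeGraph (Fin (12 * s + 8))),
      R.HasGenus g} (12 * s ^ 2 + 9 * s + 2) := by
    refine ⟨⟨R, hR⟩, ?_⟩
    rintro g ⟨R', -, hR'⟩
    have hF' := R'.three_mul_card_face_le (by omega)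
    rw [hmul] at hF'
    rw [Nat.card_fin] at hR'
    zify at hE hF' ⊢
    push_cast at hR'
    -- The inequalities give `6 g ≥ 72 s² + 54 s + 10`, and integrality of `g` does the rounding.
    linarith
  unfold IsMinimumGenus minimumGenus
  rwa [hleast.csInf_eq]

end RotationSystem

/-! ### From a pentagonal rotation to a rotation system of type `(5)`. -/

open SimpleGraph

/-- A rotation of the complete graph on `V`, given by the successor `nxt u v` of `v` in the cyclic
order of the neighbours of `u`, all of whose faces are triangles but for the pentagon `p`.
Transitivity at each vertex is phrased by means of invariant predicates. -/
structure IsPentagonalRotation {V : Type*} (nxt : V → V → V) (p : ZMod 5 → V) : Prop where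
  ne : ∀ u v, u ≠ v → nxt u v ≠ u
  cyclic : ∀ (u : V) (P : V → Prop), (∀ v, v ≠ u → (P v ↔ P (nxt u v))) →
    ∀ v w, v ≠ u → w ≠ u → (P v ↔ P w)
  triangle : ∀ u v, u ≠ v → (∀ i, ¬(u = p i ∧ v = p (i + 1))) → nxt (nxt v u) v = u
  closed : ∀ u v, u ≠ v → (∀ i, ¬(u = p i ∧ v = p (i + 1))) →
    ∀ i, ¬(v = p i ∧ nxt v u = p (i + 1))
  pentagon : ∀ i, nxt (p (i + 1)) (p i) = p (i + 2)
  injective : Function.Injective p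

namespace IsPentagonalRotation

variable {V : Type*} {nxt : V → V → V} {p : ZMod 5 → V}

theorem transport (h : IsPentagonalRotation nxt p) {W : Type*} (e : V ≃ W) :
    IsPentagonalRotation (fun u v => e (nxt (e.symm u) (e.symm v))) (e ∘ p) where
  ne u v huv := by
    rw [Ne, ← e.eq_symm_apply]
    exact h.ne _ _ (e.symm.injective.ne huv)
  cyclic u P hP v w hv hw := by
    have := h.cyclic (e.symm u) (P ∘ e) (fun x hx => by
      simpa using hP (e x) (by rwa [Ne, ← e.eq_symm_apply])) (e.symm v) (e.symm w)
      (e.symm.injective.ne hv) (e.symm.injective.ne hw)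
    simpa using this
  triangle u v huv hp := by
    rw [← e.eq_symm_apply, e.symm_apply_apply]
    exact h.triangle _ _ (e.symm.injective.ne huv) fun i hi => hp i
      ⟨e.symm_apply_eq.1 hi.1, e.symm_apply_eq.1 hi.2⟩
  closed u v huv hp i hi := by
    refine h.closed (e.symm u) (e.symm v) (e.symm.injective.ne huv) (fun i hi => hp i
      ⟨e.symm_apply_eq.1 hi.1, e.symm_apply_eq.1 hi.2⟩) i ⟨e.symm_apply_eq.2 hi.1, ?_⟩
    exact e.injective hi.2
  pentagon i := by simp [h.pentagon]
  injective := e.injective.comp h.injective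

/-- The successor of an edge end in the boundary walk of its face. -/
def face (h : IsPentagonalRotation nxt p) (d : (completeGraph V).Dart) : (completeGraph V).Dart :=
  ⟨(d.snd, nxt d.snd d.fst), (h.ne _ _ d.adj.ne.symm).symm⟩

/-- The sides of the pentagon. -/
def side (h : IsPentagonalRotation nxt p) (i : ZMod 5) : (completeGraph V).Dart :=
  ⟨(p i, p (i + 1)), h.injective.ne (by rw [Ne, left_eq_add]; decide)⟩

variable (h : IsPentagonalRotation nxt p)

theorem face_side (i : ZMod 5) : h.face (h.side i) = h.side (i + 1) := by
  apply Dart.ext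
  simp only [face, side, h.pentagon]
  rw [add_assoc]; rfl

theorem side_injective : Function.Injective h.side := fun _ _ hij =>
  h.injective (congrArg (fun d : (completeGraph V).Dart => d.fst) hij)

theorem not_side_iff (d : (completeGraph V).Dart) :
    d ∉ Set.range h.side ↔ ∀ i, ¬(d.fst = p i ∧ d.snd = p (i + 1)) := by
  simp only [Set.mem_range, not_exists]
  refine forall_congr' fun i => not_congr ⟨?_, fun hi => ?_⟩
  · rintro rfl; exact ⟨rfl, rfl⟩
  · exact Dart.ext _ _ (Prod.ext hi.1.symm hi.2.symm)

theorem face_notMem_side {d : (completeGraph V).Dart} (hd : d ∉ Set.range h.side) :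
    h.face d ∉ Set.range h.side := by
  rw [not_side_iff] at hd ⊢
  exact h.closed _ _ d.adj.ne hd

theorem face_face_snd {d : (completeGraph V).Dart} (hd : d ∉ Set.range h.side) :
    (h.face (h.face d)).snd = d.fst :=
  h.triangle _ _ d.adj.ne ((h.not_side_iff d).1 hd)

theorem face_face_face {d : (completeGraph V).Dart} (hd : d ∉ Set.range h.side) :
    h.face (h.face (h.face d)) = d := by
  have h1 := h.face_face_snd hd
  have h2 := h.face_face_snd (h.face_notMem_side hd)
  exact Dart.ext _ _ (Prod.ext h1 h2)

/-- A side of the pentagon is preceded by the previous side; any other dart is the image of its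
second iterate, because the third iterate fixes it. On a finite set this yields bijectivity, so
`IsPentagonalRotation` need not demand that `nxt u` be injective. -/
theorem face_surjective : Function.Surjective h.face := by
  intro d
  by_cases hd : d ∈ Set.range h.side
  · obtain ⟨i, rfl⟩ := hd
    exact ⟨h.side (i - 1), by rw [face_side, sub_add_cancel]⟩
  · exact ⟨_, h.face_face_face hd⟩

theorem face_bijective [Finite V] : Function.Bijective h.face :=
  have : Finite (completeGraph V).Dart := Finite.of_injective _ Dart.toProd_injective
  Finite.injective_iff_bijective.1 (Finite.injective_iff_surjective.2 h.face_surjective)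

/-- The rotation system of a pentagonal rotation. -/
noncomputable def rotationSystem [Finite V] : RotationSystem (completeGraph V) where
  rot := Equiv.ofBijective h.face h.face_bijective * RotationSystem.flip _
  fst_rot _ := rfl
  sameCycle_of_fst_eq := by
    rintro ⟨⟨u, v⟩, huv⟩ ⟨⟨u', w⟩, huw⟩ (rfl : u = u')
    set r : Equiv.Perm (completeGraph V).Dart :=
      Equiv.ofBijective h.face h.face_bijective * RotationSystem.flip _ with hr
    -- The invariant predicate is membership in the orbit of the first dart.
    have := h.cyclic u (fun x => ∀ hx : (completeGraph V).Adj u x,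
      r.SameCycle ⟨(u, v), huv⟩ ⟨(u, x), hx⟩) ?_ v w huv.ne.symm huw.ne.symm
    · exact this.1 (fun _ => .refl _ _) huw
    · intro x hx
      have hstep : r ⟨(u, x), hx.symm⟩ = ⟨(u, nxt u x), (h.ne _ _ hx.symm).symm⟩ := rfl
      constructor
      · intro hc _
        exact hstep ▸ Equiv.Perm.sameCycle_apply_right.2 (hc hx.symm)
      · intro hc _
        exact Equiv.Perm.sameCycle_apply_right.1 (hstep ▸ hc (h.ne _ _ hx.symm).symm)

variable [Finite V]

theorem rotationSystem_facePerm (d : (completeGraph V).Dart) :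
    h.rotationSystem.facePerm d = h.face d := by
  change h.face d.symm.symm = _
  rw [Dart.symm_symm]

/-- Face tracing is translation by one on the sides indexed by `ZMod 5`, so they form one orbit. -/
theorem zpow_facePerm_side (k : ℤ) (i : ZMod 5) :
    (h.rotationSystem.facePerm ^ k) (h.side i) = h.side (i + k) := by
  induction k with
  | zero => simp
  | succ k ih =>
    rw [add_comm (k : ℤ) 1, zpow_add, zpow_one, Equiv.Perm.mul_apply, ih, rotationSystem_facePerm,
      face_side]
    push_cast; ring_nf
  | pred k ih =>
    rw [sub_eq_neg_add, zpow_add, Equiv.Perm.mul_apply, ih, zpow_neg_one, Equiv.Perm.inv_eq_iff_eq,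
      rotationSystem_facePerm, face_side]
    push_cast; ring_nf

theorem faceLength_side :
    h.rotationSystem.faceLength (h.rotationSystem.faceOf (h.side 0)) = 5 := by
  have : {d | h.rotationSystem.faceOf d = h.rotationSystem.faceOf (h.side 0)} =
      Set.range h.side := by
    ext d
    rw [Set.mem_ofPred_eq, eq_comm, RotationSystem.faceOf_eq_faceOf_iff]
    constructor
    · rintro ⟨k, rfl⟩
      exact ⟨_, (h.zpow_facePerm_side k 0).symm⟩
    · rintro ⟨i, rfl⟩
      exact ⟨i.val, by rw [zpow_facePerm_side]; simp⟩
  change Nat.card ({d | h.rotationSystem.faceOf d = _} : Set _) = 5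
  rw [this, Nat.card_range_of_injective h.side_injective, Nat.card_zmod]

theorem faceLength_of_notMem_side {d : (completeGraph V).Dart} (hd : d ∉ Set.range h.side) :
    h.rotationSystem.faceLength (h.rotationSystem.faceOf d) = 3 := by
  set R := h.rotationSystem with hR
  have h3 : (R.facePerm ^ 3) d = d := by
    simp only [pow_succ, pow_zero, one_mul, Equiv.Perm.mul_apply, hR, rotationSystem_facePerm]
    exact h.face_face_face hd
  have hset : {e | R.faceOf e = R.faceOf d} =
      {d, R.facePerm d, R.facePerm (R.facePerm d)} := by
    ext e
    rw [Set.mem_ofPred_eq, eq_comm, RotationSystem.faceOf_eq_faceOf_iff]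
    constructor
    · rintro ⟨k, rfl⟩
      have hk : (R.facePerm ^ k) d = (R.facePerm ^ (k % 3)) d := by
        conv_lhs => rw [← Int.emod_add_mul_ediv k 3, zpow_add, Equiv.Perm.mul_apply, zpow_mul]
        congr 1
        exact Equiv.Perm.zpow_apply_eq_self_of_apply_eq_self h3 _
      have : k % 3 = 0 ∨ k % 3 = 1 ∨ k % 3 = 2 := by omega
      rcases this with h0 | h1 | h2
      · left; rw [hk, h0]; rfl
      · right; left; rw [hk, h1]; rfl
      · right; right; rw [hk, h2]; rfl
    · rintro (rfl | rfl | rfl)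
      · exact .refl _ _
      · exact Equiv.Perm.sameCycle_apply_right.2 (.refl _ _)
      · exact Equiv.Perm.sameCycle_apply_right.2 (Equiv.Perm.sameCycle_apply_right.2 (.refl _ _))
  have hne : R.facePerm (R.facePerm d) ≠ d := by
    intro hdd
    have := R.facePerm_apply_ne d
    rw [← hdd] at h3
    simp only [pow_succ, pow_zero, one_mul, Equiv.Perm.mul_apply] at h3
    rw [hdd, hdd] at h3
    exact this h3
  change Nat.card ({e | R.faceOf e = R.faceOf d} : Set _) = 3
  rw [hset]
  exact Set.ncard_eq_three.2 ⟨_, _, _, (R.facePerm_apply_ne d).symm, hne.symm,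
    (R.facePerm_apply_ne _).symm, rfl⟩

theorem isOfSingleType : h.rotationSystem.IsOfSingleType 5 := by
  refine ⟨_, h.faceLength_side, fun f hf => ?_⟩
  obtain ⟨d, rfl⟩ := h.rotationSystem.exists_faceOf_eq f
  apply h.faceLength_of_notMem_side
  rintro ⟨i, rfl⟩
  refine hf ((RotationSystem.faceOf_eq_faceOf_iff _ _ _).2 ⟨-i.val, ?_⟩)
  rw [zpow_facePerm_side]; simp

end IsPentagonalRotation

/-! ### The case `s = 1`: an explicit rotation of `K_20`. -/

/-- The cyclic orders of the neighbours in a rotation of the complete graph on 20 vertices. -/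
def rowsTwenty : List (List (Fin 20)) :=
  [[1, 9, 16, 13, 18, 7, 14, 3, 17, 6, 12, 19, 8, 10, 5, 4, 15, 11, 2],
   [0, 2, 10, 16, 14, 18, 8, 12, 4, 17, 7, 13, 19, 6, 11, 3, 5, 15, 9],
   [0, 11, 16, 12, 18, 6, 13, 5, 17, 8, 14, 19, 7, 9, 4, 3, 15, 10, 1],
   [0, 14, 5, 1, 11, 13, 15, 2, 4, 12, 16, 6, 8, 19, 9, 7, 18, 10, 17],
   [0, 5, 13, 16, 7, 6, 19, 10, 8, 18, 11, 17, 1, 12, 3, 2, 9, 14, 15],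
   [0, 10, 12, 9, 11, 6, 18, 15, 1, 3, 14, 16, 8, 7, 19, 17, 2, 13, 4],
   [0, 17, 14, 13, 2, 18, 5, 11, 1, 19, 4, 7, 8, 3, 16, 9, 10, 15, 12],
   [0, 18, 3, 9, 2, 19, 5, 8, 6, 4, 15, 13, 1, 17, 16, 10, 11, 12, 14],
   [0, 19, 3, 6, 7, 5, 16, 11, 9, 15, 14, 2, 17, 13, 12, 1, 18, 4, 10],
   [0, 1, 15, 8, 11, 5, 12, 17, 18, 14, 4, 2, 7, 3, 19, 13, 10, 6, 16],
   [0, 8, 4, 19, 14, 11, 7, 16, 1, 2, 15, 6, 9, 13, 17, 3, 18, 12, 5],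
   [0, 15, 19, 12, 7, 10, 14, 17, 4, 18, 13, 3, 1, 6, 5, 9, 8, 16, 2],
   [0, 6, 15, 17, 9, 5, 10, 18, 2, 16, 3, 4, 1, 8, 13, 14, 7, 11, 19],
   [0, 16, 4, 5, 2, 6, 14, 12, 8, 17, 10, 9, 19, 1, 7, 15, 3, 11, 18],
   [0, 7, 12, 13, 6, 17, 11, 10, 19, 2, 8, 15, 4, 9, 18, 1, 16, 5, 3],
   [0, 4, 14, 8, 9, 1, 5, 18, 16, 17, 12, 6, 10, 2, 3, 13, 7, 19, 11],
   [0, 9, 6, 3, 12, 2, 11, 8, 5, 14, 1, 10, 7, 17, 15, 18, 19, 4, 13],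
   [0, 3, 10, 13, 8, 2, 5, 19, 18, 9, 12, 15, 16, 7, 1, 4, 11, 14, 6],
   [0, 13, 11, 4, 8, 1, 14, 9, 17, 19, 16, 15, 5, 6, 2, 12, 10, 3, 7],
   [0, 12, 11, 15, 16, 18, 17, 5, 7, 2, 14, 10, 4, 6, 1, 13, 9, 3, 8]]

/-- The successor of `v` in the cyclic order at `u` recorded in `rowsTwenty`. -/
def nextTwenty (u v : Fin 20) : Fin 20 :=
  let r := rowsTwenty.getD u []
  r.getD ((r.idxOf v + 1) % 19) 0

/-- The pentagon of `nextTwenty`. -/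
def pentagonTwenty : ZMod 5 → Fin 20 := ![7, 15, 19, 16, 4]

theorem nextTwenty_cyclic (u : Fin 20) (P : Fin 20 → Prop)
    (hP : ∀ v, v ≠ u → (P v ↔ P (nextTwenty u v))) (v w : Fin 20) (hv : v ≠ u) (hw : w ≠ u) :
    P v ↔ P w := by
  -- A universally quantified predicate cannot be evaluated. Only the combinatorics of the rows is
  -- decided, and an induction along the row transfers it to `P`.
  have hne : ∀ u : Fin 20, ∀ i < 19, (rowsTwenty.getD u []).getD i 0 ≠ u := by decide +kernel
  have hstep : ∀ u : Fin 20, ∀ i < 18, nextTwenty u ((rowsTwenty.getD u []).getD i 0) =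
      (rowsTwenty.getD u []).getD (i + 1) 0 := by decide +kernel
  have hmem : ∀ u v : Fin 20, v ≠ u → ∃ i < 19, (rowsTwenty.getD u []).getD i 0 = v := by
    decide +kernel
  have key : ∀ i < 19, (P ((rowsTwenty.getD u []).getD i 0) ↔
      P ((rowsTwenty.getD u []).getD 0 0)) := by
    intro i
    induction i with
    | zero => exact fun _ => Iff.rfl
    | succ i ih =>
      intro hi
      rw [← hstep u i (by omega), ← hP _ (hne u i (by omega))]
      exact ih (by omega)
  obtain ⟨i, hi, rfl⟩ := hmem u v hv
  obtain ⟨j, hj, rfl⟩ := hmem u w hw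
  exact (key i hi).trans (key j hj).symm

theorem isPentagonalRotation_nextTwenty : IsPentagonalRotation nextTwenty pentagonTwenty where
  ne := by decide +kernel
  cyclic := nextTwenty_cyclic
  triangle := by decide +kernel
  closed := by decide +kernel
  pentagon := by decide +kernel
  injective := by decide +kernel

/-! ### The log of the current graph for `s ≥ 2`. -/

/-- The log of the single circuit of a current graph with currents in `ℤ / (12 * s + 3)`: the
current that follows the current `a`, both being represented by positive numbers below
`12 * s + 3`.  The values at `3 * s + 1`, `6 * s + 1`, `6 * s + 2`, `9 * s + 4` and `12 * s + 1`,
which are followed by a vortex, are not used. -/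
def logNext (s a : ℕ) : ℕ :=
  if a = 1 then 3 * s + 1
  else if a = 2 then 7 * s + 4
  else if a = 2 * s then 6 * s
  else if a = 3 * s then 12 * s + 2
  else if a = 4 * s then 10 * s + 3
  else if a + 1 = 5 * s then 5 * s + 1
  else if a = 5 * s then 2 * s
  else if a = 5 * s + 1 then 1
  else if a = 6 * s + 3 then 8 * s + 3
  else if a = 7 * s + 2 then 12 * s + 1
  else if a = 7 * s + 3 then 7 * s + 2
  else if a = 9 * s + 2 then 9 * s + 3
  else if a = 9 * s + 3 then 7 * s + 3
  else if a = 10 * s + 3 then 3 * s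
  else if a = 12 * s + 2 then 5 * s
  else if a < 2 * s then if a % 2 = 1 then 9 * s + 4 + (a - 3) / 2 else 5 * s + a / 2
  else if a < 3 * s then 6 * s + 1 - a
  else if a < 4 * s then 6 * s - a
  else if a < 5 * s then 2 * a + 2 * s + 3
  else if a ≤ 6 * s then 2 * a - 10 * s - 1
  else if a ≤ 7 * s + 1 then 14 * s + 6 - a
  else if a ≤ 8 * s + 2 then 14 * s + 5 - a
  else if a ≤ 9 * s + 1 then 2 * a - 6 * s - 2
  else if a ≤ 10 * s + 2 then 2 * a - 18 * s - 6
  else if a % 2 = 0 then 5 * s - 1 - (12 * s - a) / 2 else 9 * s + 1 - (12 * s - 1 - a) / 2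

namespace logNext

variable {s : ℕ}

theorem eq_one {a : ℕ} (ha : a = 1) : logNext s a = 3 * s + 1 := by
  unfold logNext
  exact if_pos (by omega)

theorem eq_two {a : ℕ} (ha : a = 2) : logNext s a = 7 * s + 4 := by
  unfold logNext
  -- The number of iterations is the number of branches of `logNext` that precede the wanted one,
  -- here and in the lemmas below.
  iterate 1 refine (if_neg (by omega)).trans ?_
  exact if_pos (by omega)

theorem eq_two_mul (hs : 2 ≤ s) {a : ℕ} (ha : a = 2 * s) : logNext s a = 6 * s := by
  unfold logNext
  iterate 2 refine (if_neg (by omega)).trans ?_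
  exact if_pos (by omega)

theorem eq_three_mul (hs : 2 ≤ s) {a : ℕ} (ha : a = 3 * s) : logNext s a = 12 * s + 2 := by
  unfold logNext
  iterate 3 refine (if_neg (by omega)).trans ?_
  exact if_pos (by omega)

theorem eq_four_mul (hs : 2 ≤ s) {a : ℕ} (ha : a = 4 * s) : logNext s a = 10 * s + 3 := by
  unfold logNext
  iterate 4 refine (if_neg (by omega)).trans ?_
  exact if_pos (by omega)

theorem eq_five_mul_sub_one (hs : 2 ≤ s) {a : ℕ} (ha : a = 5 * s - 1) :
    logNext s a = 5 * s + 1 := by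
  unfold logNext
  iterate 5 refine (if_neg (by omega)).trans ?_
  exact if_pos (by omega)

theorem eq_five_mul (hs : 2 ≤ s) {a : ℕ} (ha : a = 5 * s) : logNext s a = 2 * s := by
  unfold logNext
  iterate 6 refine (if_neg (by omega)).trans ?_
  exact if_pos (by omega)

theorem eq_five_mul_add_one (hs : 2 ≤ s) {a : ℕ} (ha : a = 5 * s + 1) : logNext s a = 1 := by
  unfold logNext
  iterate 7 refine (if_neg (by omega)).trans ?_
  exact if_pos (by omega)

theorem eq_six_mul_add_three {a : ℕ} (ha : a = 6 * s + 3) : logNext s a = 8 * s + 3 := by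
  unfold logNext
  iterate 8 refine (if_neg (by omega)).trans ?_
  exact if_pos (by omega)

theorem eq_seven_mul_add_two (hs : 2 ≤ s) {a : ℕ} (ha : a = 7 * s + 2) :
    logNext s a = 12 * s + 1 := by
  unfold logNext
  iterate 9 refine (if_neg (by omega)).trans ?_
  exact if_pos (by omega)

theorem eq_seven_mul_add_three (hs : 2 ≤ s) {a : ℕ} (ha : a = 7 * s + 3) :
    logNext s a = 7 * s + 2 := by
  unfold logNext
  iterate 10 refine (if_neg (by omega)).trans ?_
  exact if_pos (by omega)

theorem eq_nine_mul_add_two (hs : 2 ≤ s) {a : ℕ} (ha : a = 9 * s + 2) :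
    logNext s a = 9 * s + 3 := by
  unfold logNext
  iterate 11 refine (if_neg (by omega)).trans ?_
  exact if_pos (by omega)

theorem eq_nine_mul_add_three (hs : 2 ≤ s) {a : ℕ} (ha : a = 9 * s + 3) :
    logNext s a = 7 * s + 3 := by
  unfold logNext
  iterate 12 refine (if_neg (by omega)).trans ?_
  exact if_pos (by omega)

theorem eq_ten_mul_add_three (hs : 2 ≤ s) {a : ℕ} (ha : a = 10 * s + 3) : logNext s a = 3 * s := by
  unfold logNext
  iterate 13 refine (if_neg (by omega)).trans ?_
  exact if_pos (by omega)

theorem eq_twelve_mul_add_two (hs : 2 ≤ s) {a : ℕ} (ha : a = 12 * s + 2) : logNext s a = 5 * s := by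
  unfold logNext
  iterate 14 refine (if_neg (by omega)).trans ?_
  exact if_pos (by omega)

theorem eq_odd_rung (hs : 2 ≤ s) {a : ℕ} (h1 : 3 ≤ a) (h2 : a < 2 * s) (h3 : a % 2 = 1) :
    logNext s a = 9 * s + 4 + (a - 3) / 2 := by
  unfold logNext
  iterate 15 refine (if_neg (by omega)).trans ?_
  exact (if_pos (by omega)).trans (if_pos (by omega))

theorem eq_even_rung (hs : 2 ≤ s) {a : ℕ} (h1 : 3 ≤ a) (h2 : a < 2 * s) (h3 : a % 2 = 0) :
    logNext s a = 5 * s + a / 2 := by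
  unfold logNext
  iterate 15 refine (if_neg (by omega)).trans ?_
  exact (if_pos (by omega)).trans (if_neg (by omega))

theorem eq_low_top {a : ℕ} (h1 : 2 * s < a) (h2 : a < 3 * s) :
    logNext s a = 6 * s + 1 - a := by
  unfold logNext
  iterate 16 refine (if_neg (by omega)).trans ?_
  exact if_pos (by omega)

theorem eq_high_top {a : ℕ} (h1 : 3 * s + 2 ≤ a) (h2 : a < 4 * s) :
    logNext s a = 6 * s - a := by
  unfold logNext
  iterate 17 refine (if_neg (by omega)).trans ?_
  exact if_pos (by omega)

theorem eq_neg_high_bottom {a : ℕ} (h1 : 4 * s < a) (h2 : a + 1 < 5 * s) :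
    logNext s a = 2 * a + 2 * s + 3 := by
  unfold logNext
  iterate 18 refine (if_neg (by omega)).trans ?_
  exact if_pos (by omega)

theorem eq_neg_low_bottom {a : ℕ} (h1 : 5 * s + 2 ≤ a) (h2 : a ≤ 6 * s) :
    logNext s a = 2 * a - 10 * s - 1 := by
  unfold logNext
  iterate 19 refine (if_neg (by omega)).trans ?_
  exact if_pos (by omega)

theorem eq_low_bottom {a : ℕ} (h1 : 6 * s + 4 ≤ a) (h2 : a ≤ 7 * s + 1) :
    logNext s a = 14 * s + 6 - a := by
  unfold logNext
  iterate 20 refine (if_neg (by omega)).trans ?_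
  exact if_pos (by omega)

theorem eq_high_bottom {a : ℕ} (h1 : 7 * s + 4 ≤ a) (h2 : a ≤ 8 * s + 2) :
    logNext s a = 14 * s + 5 - a := by
  unfold logNext
  iterate 21 refine (if_neg (by omega)).trans ?_
  exact if_pos (by omega)

theorem eq_neg_high_top {a : ℕ} (h1 : 8 * s + 3 ≤ a) (h2 : a ≤ 9 * s + 1) :
    logNext s a = 2 * a - 6 * s - 2 := by
  unfold logNext
  iterate 22 refine (if_neg (by omega)).trans ?_
  exact if_pos (by omega)

theorem eq_neg_low_top {a : ℕ} (h1 : 9 * s + 5 ≤ a) (h2 : a ≤ 10 * s + 2) :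
    logNext s a = 2 * a - 18 * s - 6 := by
  unfold logNext
  iterate 23 refine (if_neg (by omega)).trans ?_
  exact if_pos (by omega)

theorem eq_neg_odd_rung (hs : 2 ≤ s) {a : ℕ} (h1 : 10 * s + 4 ≤ a) (h2 : a ≤ 12 * s)
    (h3 : a % 2 = 0) :
    logNext s a = 5 * s - 1 - (12 * s - a) / 2 := by
  unfold logNext
  iterate 24 refine (if_neg (by omega)).trans ?_
  exact if_pos (by omega)

theorem eq_neg_even_rung (hs : 2 ≤ s) {a : ℕ} (h1 : 10 * s + 4 ≤ a) (h2 : a ≤ 12 * s)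
    (h3 : a % 2 = 1) :
    logNext s a = 9 * s + 1 - (12 * s - 1 - a) / 2 := by
  unfold logNext
  iterate 25 refine (if_neg (by omega)).trans ?_
  rfl

end logNext

open logNext in
/-- The log describes a triangulation: apart from the currents followed by a vortex, `logNext`
satisfies Ringel's rule in additive form. -/
theorem logNext_spec {s a : ℕ} (hs : 2 ≤ s) (h0 : 0 < a) (hm : a < 12 * s + 3)
    (h1 : a ≠ 3 * s + 1) (h2 : a ≠ 6 * s + 1) (h3 : a ≠ 6 * s + 2) (h4 : a ≠ 9 * s + 4)
    (h5 : a ≠ 12 * s + 1) :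
    (0 < logNext s a ∧ logNext s a < 12 * s + 3 ∧ logNext s a ≠ 2 ∧ logNext s a + 1 ≠ 3 * s ∧
      logNext s a ≠ 6 * s + 1 ∧ logNext s a ≠ 6 * s + 2 ∧ logNext s a ≠ 9 * s + 2) ∧
    (logNext s a + logNext s (12 * s + 3 - logNext s a) = a ∨
      logNext s a + logNext s (12 * s + 3 - logNext s a) = a + (12 * s + 3)) := by
  -- If `b` follows `a`, translating the triangle `0, a, b` by `-b` shows that `-b` must be followed
  -- by `a - b`. In each branch `b` lies in a single range, so `-b` selects one further branch and
  -- linear arithmetic finishes. The values excluded for `b` are those preceded by a vortex.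
  obtain h | h | h | h | h | h : a < 2 * s ∨ (2 * s ≤ a ∧ a ≤ 4 * s) ∨ (4 * s < a ∧ a ≤ 6 * s) ∨
    (6 * s < a ∧ a ≤ 8 * s + 2) ∨ (8 * s + 2 < a ∧ a ≤ 10 * s + 3) ∨ 10 * s + 3 < a := by omega
  · obtain h | h | h | h :
        a = 1 ∨ a = 2 ∨ (3 ≤ a ∧ a % 2 = 1) ∨ (3 ≤ a ∧ a % 2 = 0) := by omega
    · rw [eq_one (by omega),
        eq_nine_mul_add_two hs (by omega)]; omega
    · rw [eq_two (by omega),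
        eq_five_mul_sub_one hs (by omega)]; omega
    · rw [eq_odd_rung hs (by omega) (by omega) (by omega),
        eq_low_top (by omega) (by omega)]; omega
    · rw [eq_even_rung hs (by omega) (by omega) (by omega),
        eq_low_bottom (by omega) (by omega)]; omega
  · obtain h | h | h | h | h :
        a = 2 * s ∨ (2 * s < a ∧ a < 3 * s) ∨ a = 3 * s ∨ (3 * s + 2 ≤ a ∧ a < 4 * s) ∨
        a = 4 * s := by omega
    · rw [eq_two_mul hs (by omega),
        eq_six_mul_add_three (by omega)]; omega
    · rw [eq_low_top (by omega) (by omega),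
        eq_neg_high_top (by omega) (by omega)]; omega
    · rw [eq_three_mul hs (by omega),
        eq_one (by omega)]; omega
    · rw [eq_high_top (by omega) (by omega),
        eq_neg_low_top (by omega) (by omega)]; omega
    · rw [eq_four_mul hs (by omega),
        eq_two_mul hs (by omega)]; omega
  · obtain h | h | h | h | h :
        a + 1 < 5 * s ∨ a = 5 * s - 1 ∨ a = 5 * s ∨ a = 5 * s + 1 ∨ 5 * s + 2 ≤ a := by omega
    · rw [eq_neg_high_bottom (by omega) (by omega),
        eq_even_rung hs (by omega) (by omega) (by omega)]; omega
    · rw [eq_five_mul_sub_one hs (by omega),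
        eq_seven_mul_add_two hs (by omega)]; omega
    · rw [eq_five_mul hs (by omega),
        eq_ten_mul_add_three hs (by omega)]; omega
    · rw [eq_five_mul_add_one hs (by omega),
        eq_twelve_mul_add_two hs (by omega)]; omega
    · rw [eq_neg_low_bottom (by omega) (by omega),
        eq_neg_odd_rung hs (by omega) (by omega) (by omega)]; omega
  · obtain h | h | h | h | h :
        a = 6 * s + 3 ∨ (6 * s + 4 ≤ a ∧ a ≤ 7 * s + 1) ∨ a = 7 * s + 2 ∨ a = 7 * s + 3 ∨
        7 * s + 4 ≤ a := by omega
    · rw [eq_six_mul_add_three (by omega),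
        eq_four_mul hs (by omega)]; omega
    · rw [eq_low_bottom (by omega) (by omega),
        eq_neg_high_bottom (by omega) (by omega)]; omega
    · rw [eq_seven_mul_add_two hs (by omega),
        eq_two (by omega)]; omega
    · rw [eq_seven_mul_add_three hs (by omega),
        eq_five_mul_add_one hs (by omega)]; omega
    · rw [eq_high_bottom (by omega) (by omega),
        eq_neg_low_bottom (by omega) (by omega)]; omega
  · obtain h | h | h | h | h :
        a ≤ 9 * s + 1 ∨ a = 9 * s + 2 ∨ a = 9 * s + 3 ∨ (9 * s + 5 ≤ a ∧ a ≤ 10 * s + 2) ∨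
        a = 10 * s + 3 := by omega
    · rw [eq_neg_high_top (by omega) (by omega),
        eq_odd_rung hs (by omega) (by omega) (by omega)]; omega
    · rw [eq_nine_mul_add_two hs (by omega),
        eq_three_mul hs (by omega)]; omega
    · rw [eq_nine_mul_add_three hs (by omega),
        eq_five_mul hs (by omega)]; omega
    · rw [eq_neg_low_top (by omega) (by omega),
        eq_neg_even_rung hs (by omega) (by omega) (by omega)]; omega
    · rw [eq_ten_mul_add_three hs (by omega),
        eq_nine_mul_add_three hs (by omega)]; omega
  · obtain h | h | h :
        (a ≤ 12 * s ∧ a % 2 = 0) ∨ (a ≤ 12 * s ∧ a % 2 = 1) ∨ a = 12 * s + 2 := by omega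
    · rw [eq_neg_odd_rung hs (by omega) (by omega) (by omega),
        eq_high_bottom (by omega) (by omega)]; omega
    · rw [eq_neg_even_rung hs (by omega) (by omega) (by omega),
        eq_high_top (by omega) (by omega)]; omega
    · rw [eq_twelve_mul_add_two hs (by omega),
        eq_seven_mul_add_three hs (by omega)]; omega

/-! ### The four arcs of the log. -/

section Segments

open logNext

/-- The arcs into which the log is divided by the currents `1`, `3 * s`, `3 * s + 1`, `6 * s + 1`,
`6 * s + 2`, `9 * s + 2`, `9 * s + 4` and `12 * s + 1`. -/
theorem logNext_segments {s : ℕ} (hs : 2 ≤ s) (R : ℕ → Prop)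
    (hR : ∀ a, 0 < a → a < 12 * s + 3 → a ≠ 1 → a ≠ 3 * s → a ≠ 3 * s + 1 → a ≠ 6 * s + 1 →
      a ≠ 6 * s + 2 → a ≠ 9 * s + 2 → a ≠ 9 * s + 4 → a ≠ 12 * s + 1 → (R a ↔ R (logNext s a))) :
    ((R 2 ↔ R 1) ∧ (R (9 * s + 3) ↔ R (12 * s + 1)) ∧ (R (3 * s - 1) ↔ R (3 * s)) ∧
      (R (12 * s + 2) ↔ R (9 * s + 4))) ∧
    ∀ b : Prop, (R 1 ↔ b) → (R (3 * s) ↔ b) → (R (3 * s + 1) ↔ b) → (R (6 * s + 1) ↔ b) →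
      (R (6 * s + 2) ↔ b) → (R (9 * s + 2) ↔ b) → (R (9 * s + 3) ↔ b) → (R (12 * s + 2) ↔ b) →
      ∀ a, 0 < a → a < 12 * s + 3 → (R a ↔ b) := by
  have step : ∀ {a b : ℕ}, logNext s a = b → 0 < a ∧ a < 12 * s + 3 ∧ a ≠ 1 ∧ a ≠ 3 * s ∧
      a ≠ 3 * s + 1 ∧ a ≠ 6 * s + 1 ∧ a ≠ 6 * s + 2 ∧ a ≠ 9 * s + 2 ∧ a ≠ 9 * s + 4 ∧
      a ≠ 12 * s + 1 → (R a ↔ R b) := by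
    rintro a _ rfl ⟨h0, h1, h2, h3, h4, h5, h6, h7, h8, h9⟩
    exact hR a h0 h1 h2 h3 h4 h5 h6 h7 h8 h9
  -- the two strands along the rails
  have top1 : ∀ i, i + 2 ≤ s → (R (3 * s - 1 - i) ↔ R (3 * s + 2 + i)) := fun i hi =>
    step ((eq_low_top (by omega) (by omega)).trans (by omega)) (by omega)
  have top : ∀ i, i + 2 ≤ s → (R (3 * s + 2 + i) ↔ R (3 * s - 1)) := by
    intro i
    induction i with
    | zero => exact fun hi => (top1 0 hi).symm
    | succ i ih =>
      intro hi
      rw [← ih (by omega), ← top1 (i + 1) hi]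
      exact (step ((eq_high_top (by omega) (by omega)).trans (by omega)) (by omega)).symm
  have bot1 : ∀ i, i + 2 ≤ s → (R (7 * s + 4 + i) ↔ R (7 * s + 1 - i)) := fun i hi =>
    step ((eq_high_bottom (by omega) (by omega)).trans (by omega)) (by omega)
  have bot : ∀ i, i + 2 ≤ s → (R (7 * s + 1 - i) ↔ R (7 * s + 4)) := by
    intro i
    induction i with
    | zero => exact fun hi => (bot1 0 hi).symm
    | succ i ih =>
      intro hi
      rw [← ih (by omega), ← bot1 (i + 1) hi]
      exact (step ((eq_low_bottom (by omega) (by omega)).trans (by omega)) (by omega)).symm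
  -- the two strands that zigzag along the rungs
  have zig1 : ∀ i, i + 2 ≤ s → (R (9 * s + 1 - i) ↔ R (12 * s - 2 * i)) := fun i hi =>
    step ((eq_neg_high_top (by omega) (by omega)).trans (by omega)) (by omega)
  have zig2 : ∀ i, i + 2 ≤ s → (R (12 * s - 2 * i) ↔ R (5 * s - 1 - i)) := fun i hi =>
    step ((eq_neg_odd_rung hs (by omega) (by omega) (by omega)).trans (by omega)) (by omega)
  have zig3 : ∀ i, i + 3 ≤ s → (R (5 * s - 2 - i) ↔ R (12 * s - 1 - 2 * i)) := fun i hi =>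
    step ((eq_neg_high_bottom (by omega) (by omega)).trans (by omega)) (by omega)
  have zig4 : ∀ i, i + 3 ≤ s → (R (12 * s - 1 - 2 * i) ↔ R (9 * s + 1 - i)) := fun i hi =>
    step ((eq_neg_even_rung hs (by omega) (by omega) (by omega)).trans (by omega)) (by omega)
  have zig : ∀ i, i + 2 ≤ s → (R (5 * s - 1 - i) ↔ R (5 * s - 1)) := by
    intro i
    induction i with
    | zero => exact fun _ => Iff.rfl
    | succ i ih =>
      intro hi
      rw [show 5 * s - 1 - (i + 1) = 5 * s - 2 - i by omega, zig3 i (by omega), zig4 i (by omega),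
        zig1 i (by omega), zig2 i (by omega), ih (by omega)]
  have zag1 : ∀ i, i + 2 ≤ s → (R (5 * s + 2 + i) ↔ R (2 * i + 3)) := fun i hi =>
    step ((eq_neg_low_bottom (by omega) (by omega)).trans (by omega)) (by omega)
  have zag2 : ∀ i, i + 2 ≤ s → (R (2 * i + 3) ↔ R (9 * s + 4 + i)) := fun i hi =>
    step ((eq_odd_rung hs (by omega) (by omega) (by omega)).trans (by omega)) (by omega)
  have zag3 : ∀ i, i + 3 ≤ s → (R (9 * s + 5 + i) ↔ R (2 * i + 4)) := fun i hi =>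
    step ((eq_neg_low_top (by omega) (by omega)).trans (by omega)) (by omega)
  have zag4 : ∀ i, i + 3 ≤ s → (R (2 * i + 4) ↔ R (5 * s + 2 + i)) := fun i hi =>
    step ((eq_even_rung hs (by omega) (by omega) (by omega)).trans (by omega)) (by omega)
  have zag : ∀ i, i + 2 ≤ s → (R (9 * s + 4 + i) ↔ R (9 * s + 4)) := by
    intro i
    induction i with
    | zero => exact fun _ => Iff.rfl
    | succ i ih =>
      intro hi
      rw [show 9 * s + 4 + (i + 1) = 9 * s + 5 + i by omega, zag3 i (by omega), zag4 i (by omega),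
        zag1 i (by omega), zag2 i (by omega), ih (by omega)]
  -- the rest of the log
  have e1 := step (eq_two rfl) (by omega)
  have e2 := step (eq_six_mul_add_three rfl) (by omega)
  have e3 := step (eq_five_mul_sub_one hs rfl) (by omega)
  have e4 := step (eq_five_mul_add_one hs rfl) (by omega)
  have e5 := step (eq_nine_mul_add_three hs rfl) (by omega)
  have e6 := step (eq_seven_mul_add_three hs rfl) (by omega)
  have e7 := step (eq_seven_mul_add_two hs rfl) (by omega)
  have e8 := step (eq_four_mul hs rfl) (by omega)
  have e9 := step (eq_ten_mul_add_three hs rfl) (by omega)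
  have e10 := step (eq_twelve_mul_add_two hs rfl) (by omega)
  have e11 := step (eq_five_mul hs rfl) (by omega)
  have e12 := step (eq_two_mul hs rfl) (by omega)
  -- The index `s - 2` is the far end of each strand; these four identities join the strands to the
  -- rest of the log.
  have f1 : R (6 * s + 3) ↔ R (7 * s + 4) := by
    rw [← bot (s - 2) (by omega), show 7 * s + 1 - (s - 2) = 6 * s + 3 by omega]
  have f2 : R (8 * s + 3) ↔ R (5 * s - 1) := by
    rw [← zig (s - 2) (by omega), ← zig2 (s - 2) (by omega), ← zig1 (s - 2) (by omega),
      show 9 * s + 1 - (s - 2) = 8 * s + 3 by omega]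
  have f3 : R (4 * s) ↔ R (3 * s - 1) := by
    rw [← top (s - 2) (by omega), show 3 * s + 2 + (s - 2) = 4 * s by omega]
  have f4 : R (6 * s) ↔ R (9 * s + 4) := by
    rw [← zag (s - 2) (by omega), ← zag2 (s - 2) (by omega), ← zag1 (s - 2) (by omega),
      show 5 * s + 2 + (s - 2) = 6 * s by omega]
  refine ⟨⟨?_, ?_, ?_, ?_⟩, ?_⟩
  · rw [e1, ← f1, e2, f2, e3, e4]
  · rw [e5, e6, e7]
  · rw [← f3, e8, e9]
  · rw [e10, e11, e12, f4]
  intro b h1 h2 h3 h4 h5 h6 h7 h8 a ha ham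
  -- The hypotheses are moved along the arcs to the representatives `9 * s + 4`, `5 * s - 1`, `7 * s
  -- + 2` and `3 * s - 1`, one for each arc. Each further current is then traced to one of these or
  -- to an isolated current.
  rw [e10, e11, e12, f4] at h8
  rw [← e4, ← e3] at h1
  rw [e5, e6] at h7
  rw [← e9, ← e8, f3] at h2
  obtain h | h | h | h | h | h : a < 2 * s ∨ (2 * s ≤ a ∧ a ≤ 4 * s) ∨ (4 * s < a ∧ a ≤ 6 * s) ∨
      (6 * s < a ∧ a ≤ 8 * s + 2) ∨ (8 * s + 2 < a ∧ a ≤ 10 * s + 3) ∨ 10 * s + 3 < a := by omega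
  · obtain h | h | h | h :
        a = 1 ∨ a = 2 ∨ (∃ i, i + 2 ≤ s ∧ a = 2 * i + 3) ∨ (∃ i, i + 3 ≤ s ∧ a = 2 * i + 4) := by
      obtain h | h | h | h : a = 1 ∨ a = 2 ∨ (3 ≤ a ∧ a % 2 = 1) ∨ (3 ≤ a ∧ a % 2 = 0) := by omega
      · exact .inl h
      · exact .inr (.inl h)
      · exact .inr (.inr (.inl ⟨(a - 3) / 2, by omega, by omega⟩))
      · exact .inr (.inr (.inr ⟨(a - 4) / 2, by omega, by omega⟩))
    · rwa [h, ← e4, ← e3]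
    · rwa [h, e1, ← f1, e2, f2]
    · obtain ⟨i, hi, rfl⟩ := h
      rwa [zag2 i hi, zag i hi]
    · obtain ⟨i, hi, rfl⟩ := h
      rwa [zag4 i hi, zag1 i (by omega), zag2 i (by omega), zag i (by omega)]
  · obtain h | h | h | h | h : a = 2 * s ∨ (2 * s < a ∧ a < 3 * s) ∨ a = 3 * s ∨ a = 3 * s + 1 ∨
      (3 * s + 2 ≤ a ∧ a ≤ 4 * s) := by omega
    · rwa [h, e12, f4]
    · rwa [show a = 3 * s - 1 - (3 * s - 1 - a) by omega, top1 _ (by omega), top _ (by omega)]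
    · rwa [h, ← e9, ← e8, f3]
    · rwa [h]
    · rwa [show a = 3 * s + 2 + (a - (3 * s + 2)) by omega, top _ (by omega)]
  · obtain h | h | h | h : a < 5 * s ∨ a = 5 * s ∨ a = 5 * s + 1 ∨ 5 * s + 2 ≤ a := by omega
    · rwa [show a = 5 * s - 1 - (5 * s - 1 - a) by omega, zig _ (by omega)]
    · rwa [h, e11, e12, f4]
    · rwa [h, ← e3]
    · rwa [show a = 5 * s + 2 + (a - (5 * s + 2)) by omega, zag1 _ (by omega), zag2 _ (by omega),
        zag _ (by omega)]
  · obtain h | h | h | h | h | h : a = 6 * s + 1 ∨ a = 6 * s + 2 ∨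
      (6 * s + 3 ≤ a ∧ a ≤ 7 * s + 1) ∨ a = 7 * s + 2 ∨ a = 7 * s + 3 ∨ 7 * s + 4 ≤ a := by omega
    · rwa [h]
    · rwa [h]
    · rwa [show a = 7 * s + 1 - (7 * s + 1 - a) by omega, bot _ (by omega), ← f1, e2, f2]
    · rwa [h]
    · rwa [h, e6]
    · rwa [show a = 7 * s + 4 + (a - (7 * s + 4)) by omega, bot1 _ (by omega), bot _ (by omega),
        ← f1, e2, f2]
  · obtain h | h | h | h | h : a ≤ 9 * s + 1 ∨ a = 9 * s + 2 ∨ a = 9 * s + 3 ∨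
      (9 * s + 4 ≤ a ∧ a ≤ 10 * s + 2) ∨ a = 10 * s + 3 := by omega
    · rwa [show a = 9 * s + 1 - (9 * s + 1 - a) by omega, zig1 _ (by omega), zig2 _ (by omega),
        zig _ (by omega)]
    · rwa [h]
    · rwa [h, e5, e6]
    · rwa [show a = 9 * s + 4 + (a - (9 * s + 4)) by omega, zag _ (by omega)]
    · rwa [h, ← e8, f3]
  · obtain h | h | h | h : (∃ i, i + 2 ≤ s ∧ a = 12 * s - 2 * i) ∨
        (∃ i, i + 3 ≤ s ∧ a = 12 * s - 1 - 2 * i) ∨ a = 12 * s + 1 ∨ a = 12 * s + 2 := by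
      obtain h | h | h | h : (a ≤ 12 * s ∧ a % 2 = 0) ∨ (a ≤ 12 * s ∧ a % 2 = 1) ∨
        a = 12 * s + 1 ∨ a = 12 * s + 2 := by omega
      · exact .inl ⟨(12 * s - a) / 2, by omega, by omega⟩
      · exact .inr (.inl ⟨(12 * s - 1 - a) / 2, by omega, by omega⟩)
      · exact .inr (.inr (.inl h))
      · exact .inr (.inr (.inr h))
    · obtain ⟨i, hi, rfl⟩ := h
      rwa [zig2 i hi, zig i hi]
    · obtain ⟨i, hi, rfl⟩ := h
      rwa [zig4 i hi, zig1 i (by omega), zig2 i (by omega), zig i (by omega)]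
    · rwa [h, ← e7]
    · rwa [h, e10, e11, e12, f4]

end Segments

/-! ### The base embedding: all edges except those between vortices. -/

namespace CurrentGraph

variable (s : ℕ)

/-- The vertices of the complete graph on `12 * s + 8` vertices: the elements of a cyclic group,
two vortices `A` and `B`, and the three vertices `X 0`, `X 1`, `X 2` of a third vortex. -/
abbrev Vertex : Type := ZMod (12 * s + 3) ⊕ (Bool ⊕ ZMod 3)

/-- The inverse of `4` in `ℤ / (12 * s + 3)`. -/
def quarter : ZMod (12 * s + 3) := 3 * s + 1

/-- The vertex `n / 4`. -/
def point (n : ℤ) : Vertex s := .inl (n * quarter s)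

/-- The first vortex. -/
def vortexA : Vertex s := .inr (.inl false)

/-- The second vortex. -/
def vortexB : Vertex s := .inr (.inl true)

/-- The vertices of the third vortex. -/
def vortexX (i : ZMod 3) : Vertex s := .inr (.inr i)

/-- Reduction modulo three. -/
def residue : ZMod (12 * s + 3) →+* ZMod 3 := ZMod.castHom ⟨4 * s + 1, by ring⟩ _

/-- The successor of a current in the log. -/
def logStep (d : ZMod (12 * s + 3)) : ZMod (12 * s + 3) := (logNext s d.val : ℕ)

/-- The rotation of the triangular embedding of the complete graph on `Vertex s` minus the edges
between vortices that is generated by the current graph. -/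
def baseNext : Vertex s → Vertex s → Vertex s
  | .inl u, .inl v =>
    if v - u = quarter s then vortexA s
    else if v - u = 2 * quarter s then vortexB s
    else if v - u = 7 * quarter s then vortexX s (residue s u)
    else if v - u = -8 * quarter s then vortexX s (residue s u + 1)
    else if v - u = -2 * quarter s then vortexX s (residue s u + 2)
    else .inl (u + logStep s (v - u))
  | .inl u, .inr (.inl false) => .inl (u - quarter s)
  | .inl u, .inr (.inl true) => .inl (u - 2 * quarter s)
  | .inl u, .inr (.inr i) =>
    if i = residue s u then .inl (u + 8 * quarter s)
    else if i = residue s u + 1 then .inl (u + 2 * quarter s)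
    else .inl (u - 7 * quarter s)
  | .inr (.inl false), .inl u => .inl (u + quarter s)
  | .inr (.inl true), .inl u => .inl (u + 2 * quarter s)
  | .inr (.inr i), .inl u =>
    if i = residue s u then .inl (u + 7 * quarter s)
    else if i = residue s u + 1 then .inl (u - 8 * quarter s)
    else .inl (u - 2 * quarter s)
  -- Vortices are not adjacent in the base graph; this value is a filler.
  | .inr _, .inr y => .inr y

theorem modulus_eq_zero : (12 * s + 3 : ZMod (12 * s + 3)) = 0 := by
  have := ZMod.natCast_self (12 * s + 3)
  push_cast at this
  exact this

theorem four_mul_quarter : 4 * quarter s = 1 := by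
  unfold quarter
  linear_combination modulus_eq_zero s

theorem residue_quarter : residue s (quarter s) = 1 := by
  have h3 : residue s 3 = 0 := map_ofNat (residue s) 3
  simp [quarter, h3]

variable {s}

/-- Dictionary between the representatives used by `logNext` and multiples of `quarter`; `j` counts
the multiples of the modulus to be added. -/
theorem natCast_eq_mul_quarter {k : ℕ} {n : ℤ} (j : ℤ)
    (h : (k : ℤ) = n * (3 * s + 1) + j * (12 * s + 3)) :
    (k : ZMod (12 * s + 3)) = n * quarter s := by
  have := congrArg (Int.cast : ℤ → ZMod (12 * s + 3)) h
  push_cast at this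
  rw [this, modulus_eq_zero, mul_zero, add_zero, quarter]

theorem natCast_ne_mul_quarter {k a : ℕ} {n : ℤ} (j : ℤ)
    (h : (k : ℤ) = n * (3 * s + 1) + j * (12 * s + 3)) (hk : k < 12 * s + 3) (ha : a < 12 * s + 3)
    (hne : a ≠ k) : (a : ZMod (12 * s + 3)) ≠ n * quarter s := by
  rw [← natCast_eq_mul_quarter j h, Ne, ZMod.natCast_eq_natCast_iff', Nat.mod_eq_of_lt hk,
    Nat.mod_eq_of_lt ha]
  exact hne

/-- `quarter` is a unit with inverse `4`, so a multiple vanishes only when the modulus divides the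
coefficient. -/
theorem int_mul_quarter_eq_zero {n : ℤ} (h1 : n ≠ 0) (h2 : |n| < 12 * s + 3) :
    (n * quarter s : ZMod (12 * s + 3)) ≠ 0 := by
  intro h
  have h4 : (n : ZMod (12 * s + 3)) = 0 := by
    linear_combination 4 * h - n * four_mul_quarter s
  rw [ZMod.intCast_zmod_eq_zero_iff_dvd] at h4
  exact h1 (Int.eq_zero_of_abs_lt_dvd h4 (by exact_mod_cast h2))

theorem point_injOn {n k : ℤ} (h : |n - k| < 12 * s + 3) (hp : point s n = point s k) : n = k := by
  by_contra hne
  have := Sum.inl_injective hp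
  refine int_mul_quarter_eq_zero (n := n - k) (by omega) h ?_
  push_cast
  linear_combination this

theorem exists_point_eq (u : ZMod (12 * s + 3)) : ∃ n : ℤ, point s n = .inl u := by
  refine ⟨4 * u.val, congrArg Sum.inl ?_⟩
  push_cast
  rw [ZMod.natCast_zmod_val]
  linear_combination u * four_mul_quarter s

theorem val_ne {d : ZMod (12 * s + 3)} {k : ℕ} {n : ℤ} (j : ℤ)
    (h : (k : ℤ) = n * (3 * s + 1) + j * (12 * s + 3)) (hd : d ≠ n * quarter s) : d.val ≠ k := by
  rintro rfl
  exact hd (by rw [← natCast_eq_mul_quarter j h, ZMod.natCast_zmod_val])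

/-- This is `logNext_spec` carried to the cyclic group. The excluded currents are those followed by
a vortex, and the negated conditions allow the rule to be applied once more at `-logStep s d`. -/
theorem logStep_spec (hs : 2 ≤ s) {d : ZMod (12 * s + 3)} (h0 : d ≠ 0) (h1 : d ≠ quarter s)
    (h2 : d ≠ 2 * quarter s) (h3 : d ≠ 7 * quarter s) (h4 : d ≠ -8 * quarter s)
    (h5 : d ≠ -2 * quarter s) :
    (logStep s d ≠ 0 ∧ -logStep s d ≠ quarter s ∧ -logStep s d ≠ 2 * quarter s ∧
      -logStep s d ≠ 7 * quarter s ∧ -logStep s d ≠ -8 * quarter s ∧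
      -logStep s d ≠ -2 * quarter s) ∧ logStep s d + logStep s (-logStep s d) = d := by
  have hlt : d.val < 12 * s + 3 := d.val_lt
  obtain ⟨⟨g0, g1, g2, g3, g4, g5, g6⟩, g⟩ := logNext_spec hs
    (Nat.pos_of_ne_zero fun h => h0 ((ZMod.val_eq_zero d).1 h)) hlt
    (val_ne (n := 1) 0 (by push_cast; ring) (by simpa using h1))
    (val_ne (n := -2) 1 (by push_cast; ring) (by simpa using h5))
    (val_ne (n := 2) 0 (by push_cast; ring) (by simpa using h2))
    (val_ne (n := 7) (-1) (by push_cast; ring) (by simpa using h3))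
    (val_ne (n := -8) 3 (by push_cast; ring) (by simpa using h4))
  set b := logNext s d.val with hb
  have hbs : logStep s d = (b : ZMod (12 * s + 3)) := rfl
  have hneg : -logStep s d = ((12 * s + 3 - b : ℕ) : ZMod (12 * s + 3)) := by
    rw [Nat.cast_sub g1.le, ZMod.natCast_self, zero_sub, hbs]
  refine ⟨⟨?_, ?_, ?_, ?_, ?_, ?_⟩, ?_⟩
  · rw [hbs, Ne, ZMod.natCast_eq_zero_iff]
    exact Nat.not_dvd_of_pos_of_lt g0 g1
  · simpa [neg_eq_iff_eq_neg, hbs] using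
      natCast_ne_mul_quarter (n := -1) (k := 9 * s + 2) (s := s) 1 (by push_cast; ring) (by omega)
        g1 g6
  · simpa [neg_eq_iff_eq_neg, hbs] using
      natCast_ne_mul_quarter (n := -2) (k := 6 * s + 1) (s := s) 1 (by push_cast; ring) (by omega)
        g1 g4
  · simpa [neg_eq_iff_eq_neg, hbs] using
      natCast_ne_mul_quarter (n := -7) (k := 3 * s - 1) (s := s) 2
        (by push_cast [show 1 ≤ 3 * s by omega]; ring) (by omega) g1 (by omega)
  · simpa [neg_eq_iff_eq_neg, hbs] using
      natCast_ne_mul_quarter (n := 8) (k := 2) (s := s) (-2) (by push_cast; ring) (by omega)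
        g1 g2
  · simpa [neg_eq_iff_eq_neg, hbs] using
      natCast_ne_mul_quarter (n := 2) (k := 6 * s + 2) (s := s) 0 (by push_cast; ring) (by omega)
        g1 g5
  · have hstep : logStep s (-logStep s d) = (logNext s (12 * s + 3 - b) : ℕ) := by
      rw [hneg, logStep, ZMod.val_natCast_of_lt (by omega)]
    rw [hstep, hbs, ← Nat.cast_add]
    rcases g with g | g
    · rw [g, ZMod.natCast_zmod_val]
    · rw [g, Nat.cast_add, ZMod.natCast_self, add_zero, ZMod.natCast_zmod_val]

section BaseNext

variable (hs : 2 ≤ s) {u v : ZMod (12 * s + 3)}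

/-- For `s ≥ 2` the modulus is at least `27`, which keeps all the small offsets in use distinct. -/
theorem mul_quarter_ne (hs : 2 ≤ s) (n k : ℤ) (hne : n - k ≠ 0 := by norm_num)
    (h : |n - k| < 27 := by norm_num) :
    (n * quarter s : ZMod (12 * s + 3)) ≠ k * quarter s := by
  intro e
  refine int_mul_quarter_eq_zero (s := s) hne (h.trans_le (by omega)) ?_
  push_cast
  linear_combination e

theorem baseNext_quarter (h : v - u = quarter s) :
    baseNext s (.inl u) (.inl v) = vortexA s := if_pos h

theorem baseNext_two (hs : 2 ≤ s) (h : v - u = 2 * quarter s) :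
    baseNext s (.inl u) (.inl v) = vortexB s := by
  have h1 := mul_quarter_ne hs 2 1
  push_cast at h1
  rw [one_mul] at h1
  simp only [baseNext, h, h1, if_true, if_false]

theorem baseNext_seven (hs : 2 ≤ s) (h : v - u = 7 * quarter s) :
    baseNext s (.inl u) (.inl v) = vortexX s (residue s u) := by
  have h1 := mul_quarter_ne hs 7 1
  have h2 := mul_quarter_ne hs 7 2
  push_cast at h1 h2
  rw [one_mul] at h1
  simp only [baseNext, h, h1, h2, if_true, if_false]

theorem baseNext_neg_eight (hs : 2 ≤ s) (h : v - u = -8 * quarter s) :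
    baseNext s (.inl u) (.inl v) = vortexX s (residue s u + 1) := by
  have h1 := mul_quarter_ne hs (-8) 1
  have h2 := mul_quarter_ne hs (-8) 2
  have h3 := mul_quarter_ne hs (-8) 7
  push_cast at h1 h2 h3
  rw [one_mul] at h1
  simp only [baseNext, h, h1, h2, h3, if_true, if_false]

theorem baseNext_neg_two (hs : 2 ≤ s) (h : v - u = -2 * quarter s) :
    baseNext s (.inl u) (.inl v) = vortexX s (residue s u + 2) := by
  have h1 := mul_quarter_ne hs (-2) 1
  have h2 := mul_quarter_ne hs (-2) 2
  have h3 := mul_quarter_ne hs (-2) 7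
  have h4 := mul_quarter_ne hs (-2) (-8)
  push_cast at h1 h2 h3 h4
  rw [one_mul] at h1
  simp only [baseNext, h, h1, h2, h3, h4, if_true, if_false]

theorem baseNext_step (h1 : v - u ≠ quarter s) (h2 : v - u ≠ 2 * quarter s)
    (h3 : v - u ≠ 7 * quarter s) (h4 : v - u ≠ -8 * quarter s) (h5 : v - u ≠ -2 * quarter s) :
    baseNext s (.inl u) (.inl v) = .inl (u + logStep s (v - u)) := by
  simp only [baseNext, h1, h2, h3, h4, h5, if_false]

theorem add_ne_self_zmod_three : ∀ i : ZMod 3, i + 1 ≠ i ∧ i + 2 ≠ i ∧ i + 2 ≠ i + 1 := by decide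

theorem zmod_three_cases : ∀ i j : ZMod 3, i = j ∨ i = j + 1 ∨ i = j + 2 := by decide

theorem baseNext_vortexX (u : ZMod (12 * s + 3)) :
    baseNext s (.inl u) (vortexX s (residue s u)) = .inl (u + 8 * quarter s) := if_pos rfl

theorem baseNext_vortexX_add_one (u : ZMod (12 * s + 3)) :
    baseNext s (.inl u) (vortexX s (residue s u + 1)) = .inl (u + 2 * quarter s) :=
  (if_neg (add_ne_self_zmod_three _).1).trans (if_pos rfl)

theorem baseNext_vortexX_add_two (u : ZMod (12 * s + 3)) :
    baseNext s (.inl u) (vortexX s (residue s u + 2)) = .inl (u - 7 * quarter s) :=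
  (if_neg (add_ne_self_zmod_three _).2.1).trans (if_neg (add_ne_self_zmod_three _).2.2)

theorem vortexX_baseNext (u : ZMod (12 * s + 3)) :
    baseNext s (vortexX s (residue s u)) (.inl u) = .inl (u + 7 * quarter s) := if_pos rfl

theorem vortexX_add_one_baseNext (u : ZMod (12 * s + 3)) :
    baseNext s (vortexX s (residue s u + 1)) (.inl u) = .inl (u - 8 * quarter s) :=
  (if_neg (add_ne_self_zmod_three _).1).trans (if_pos rfl)

theorem vortexX_add_two_baseNext (u : ZMod (12 * s + 3)) :
    baseNext s (vortexX s (residue s u + 2)) (.inl u) = .inl (u - 2 * quarter s) :=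
  (if_neg (add_ne_self_zmod_three _).2.1).trans (if_neg (add_ne_self_zmod_three _).2.2)

theorem residue_add_mul_quarter (u : ZMod (12 * s + 3)) (n : ℤ) :
    residue s (u + n * quarter s) = residue s u + n := by
  rw [map_add, map_mul, residue_quarter, mul_one, map_intCast]

/-- All faces of the base embedding are triangles. -/
theorem baseNext_baseNext (hs : 2 ≤ s) {u v : Vertex s} (huv : u ≠ v)
    (h : u.isLeft ∨ v.isLeft) : baseNext s (baseNext s v u) v = u := by
  have hX := residue_add_mul_quarter (s := s)
  rcases u with u | (_ | _) | i <;> rcases v with v | (_ | _) | j <;> try simp at h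
  · by_cases h1 : u - v = quarter s
    · rw [baseNext_quarter h1, sub_eq_iff_eq_add'.1 h1]; rfl
    by_cases h2 : u - v = 2 * quarter s
    · rw [baseNext_two hs h2, sub_eq_iff_eq_add'.1 h2]; rfl
    by_cases h3 : u - v = 7 * quarter s
    · rw [baseNext_seven hs h3, vortexX_baseNext, sub_eq_iff_eq_add'.1 h3]
    by_cases h4 : u - v = -8 * quarter s
    · rw [baseNext_neg_eight hs h4, vortexX_add_one_baseNext, sub_eq_iff_eq_add'.1 h4]
      congr 1; ring
    by_cases h5 : u - v = -2 * quarter s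
    · rw [baseNext_neg_two hs h5, vortexX_add_two_baseNext, sub_eq_iff_eq_add'.1 h5]
      congr 1; ring
    rw [baseNext_step h1 h2 h3 h4 h5]
    have h0 : u - v ≠ 0 := fun h0 => huv (congrArg Sum.inl (sub_eq_zero.1 h0))
    obtain ⟨⟨-, g1, g2, g3, g4, g5⟩, g⟩ := logStep_spec hs h0 h1 h2 h3 h4 h5
    -- Translated to the third corner, the identity `g` is exactly Ringel's rule.
    have e : v - (v + logStep s (u - v)) = -logStep s (u - v) := by ring
    rw [baseNext_step (by rwa [e]) (by rwa [e]) (by rwa [e]) (by rwa [e]) (by rwa [e]), e,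
      add_assoc,
      g, add_sub_cancel]
  · change baseNext s (.inl (u + quarter s)) (vortexA s) = _
    exact congrArg Sum.inl (by ring)
  · change baseNext s (.inl (u + 2 * quarter s)) (vortexB s) = _
    exact congrArg Sum.inl (by ring)
  · change baseNext s (baseNext s (vortexX s j) _) (vortexX s j) = _
    obtain rfl | rfl | rfl := zmod_three_cases j (residue s u)
    · rw [vortexX_baseNext]
      have := hX u 7
      push_cast at this
      -- Seven quarters raise the residue by one, so the same vortex now has index two above the
      -- residue. The other two cases shift indices in the same way.
      rw [show residue s u = residue s (u + 7 * quarter s) + 2 by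
        rw [this, add_assoc]; exact (add_zero _).symm, baseNext_vortexX_add_two]
      congr 1; ring
    · rw [vortexX_add_one_baseNext]
      have := hX u (-8)
      push_cast at this
      rw [neg_mul, ← sub_eq_add_neg] at this
      rw [show residue s u + 1 = residue s (u - 8 * quarter s) by rw [this]; rfl, baseNext_vortexX]
      congr 1; ring
    · rw [vortexX_add_two_baseNext]
      have := hX u (-2)
      push_cast at this
      rw [neg_mul, ← sub_eq_add_neg] at this
      rw [show residue s u + 2 = residue s (u - 2 * quarter s) + 1 by rw [this, add_assoc]; rfl,
        baseNext_vortexX_add_one]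
      congr 1; ring
  · exact (baseNext_quarter (by ring))
  · exact (baseNext_two hs (by ring))
  · change baseNext s (baseNext s _ (vortexX s i)) _ = vortexX s i
    obtain rfl | rfl | rfl := zmod_three_cases i (residue s v)
    · rw [baseNext_vortexX, baseNext_neg_eight hs (by ring)]
      have := hX v 8
      push_cast at this
      rw [this, add_assoc]; exact congrArg _ (add_zero _)
    · rw [baseNext_vortexX_add_one, baseNext_neg_two hs (by ring)]
      have := hX v 2
      push_cast at this
      rw [this, add_assoc]; rfl
    · rw [baseNext_vortexX_add_two, baseNext_seven hs (by ring)]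
      have := hX v (-7)
      push_cast at this
      rw [neg_mul, ← sub_eq_add_neg] at this
      rw [this]; rfl

theorem baseNext_ne (hs : 2 ≤ s) {u v : Vertex s} (huv : u ≠ v)
    (h : u.isLeft ∨ v.isLeft) : baseNext s u v ≠ u := by
  have hne : ∀ n : ℤ, n ≠ 0 → |n| < 27 → ∀ u : ZMod (12 * s + 3),
      (.inl (u + n * quarter s) : Vertex s) ≠ .inl u := by
    intro n h1 h2 u e
    refine mul_quarter_ne hs n 0 (by simpa) (by simpa) ?_
    push_cast
    linear_combination Sum.inl_injective e
  rcases u with u | (_ | _) | i <;> rcases v with v | (_ | _) | j <;> try simp at h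
  · by_cases h1 : v - u = quarter s
    · rw [baseNext_quarter h1]; exact Sum.inr_ne_inl
    by_cases h2 : v - u = 2 * quarter s
    · rw [baseNext_two hs h2]; exact Sum.inr_ne_inl
    by_cases h3 : v - u = 7 * quarter s
    · rw [baseNext_seven hs h3]; exact Sum.inr_ne_inl
    by_cases h4 : v - u = -8 * quarter s
    · rw [baseNext_neg_eight hs h4]; exact Sum.inr_ne_inl
    by_cases h5 : v - u = -2 * quarter s
    · rw [baseNext_neg_two hs h5]; exact Sum.inr_ne_inl
    have h0 : v - u ≠ 0 := fun h0 => huv (congrArg Sum.inl (sub_eq_zero.1 h0).symm)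
    rw [baseNext_step h1 h2 h3 h4 h5]
    intro e
    exact (logStep_spec hs h0 h1 h2 h3 h4 h5).1.1 (by simpa using Sum.inl_injective e)
  · simpa [baseNext, sub_eq_add_neg] using hne (-1) (by norm_num) (by norm_num) u
  · simpa [baseNext, sub_eq_add_neg] using hne (-2) (by norm_num) (by norm_num) u
  · change baseNext s (.inl u) (vortexX s j) ≠ .inl u
    obtain rfl | rfl | rfl := zmod_three_cases j (residue s u)
    · simpa [baseNext_vortexX] using hne 8 (by norm_num) (by norm_num) u
    · simpa [baseNext_vortexX_add_one] using hne 2 (by norm_num) (by norm_num) u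
    · simpa [baseNext_vortexX_add_two, sub_eq_add_neg] using hne (-7) (by norm_num) (by norm_num) u
  · exact Sum.inl_ne_inr
  · exact Sum.inl_ne_inr
  · change baseNext s (vortexX s i) (.inl v) ≠ vortexX s i
    obtain rfl | rfl | rfl := zmod_three_cases i (residue s v)
    · rw [vortexX_baseNext]; exact Sum.inl_ne_inr
    · rw [vortexX_add_one_baseNext]; exact Sum.inl_ne_inr
    · rw [vortexX_add_two_baseNext]; exact Sum.inl_ne_inr

end BaseNext

end CurrentGraph

namespace CurrentGraph

variable {s : ℕ}

/-! ### The base rotation in units of `1/4`. -/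

section Points

theorem residue_mul_quarter (n : ℤ) : residue s (n * quarter s) = n := by
  rw [map_mul, residue_quarter, mul_one, map_intCast]

theorem logStep_mul_quarter {a b : ℕ} {n k : ℤ} (i j : ℤ) (hab : logNext s a = b)
    (ha : a < 12 * s + 3) (hn : (a : ℤ) = n * (3 * s + 1) + i * (12 * s + 3))
    (hk : (b : ℤ) = k * (3 * s + 1) + j * (12 * s + 3)) :
    logStep s (n * quarter s) = k * quarter s := by
  rw [← natCast_eq_mul_quarter i hn, ← natCast_eq_mul_quarter j hk, logStep,
    ZMod.val_natCast_of_lt ha, hab]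

theorem baseNext_point_add_one (n : ℤ) :
    baseNext s (point s n) (point s (n + 1)) = vortexA s :=
  baseNext_quarter (by push_cast; ring)

theorem baseNext_point_vortexA (n : ℤ) :
    baseNext s (point s n) (vortexA s) = point s (n - 1) :=
  congrArg Sum.inl (by push_cast; ring)

theorem baseNext_point_add_two (hs : 2 ≤ s) (n : ℤ) :
    baseNext s (point s n) (point s (n + 2)) = vortexB s :=
  baseNext_two hs (by push_cast; ring)

theorem baseNext_point_vortexB (n : ℤ) :
    baseNext s (point s n) (vortexB s) = point s (n - 2) :=
  congrArg Sum.inl (by push_cast; ring)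

theorem baseNext_point_vortexX (n : ℤ) :
    baseNext s (point s n) (vortexX s n) = point s (n + 8) := by
  have := baseNext_vortexX (s := s) (n * quarter s)
  rw [residue_mul_quarter] at this
  exact this.trans (congrArg Sum.inl (by push_cast; ring))

theorem baseNext_point_vortexX_add_one (n : ℤ) :
    baseNext s (point s n) (vortexX s (n + 1)) = point s (n + 2) := by
  have := baseNext_vortexX_add_one (s := s) (n * quarter s)
  rw [residue_mul_quarter] at this
  exact this.trans (congrArg Sum.inl (by push_cast; ring))

theorem baseNext_point_vortexX_add_two (n : ℤ) :
    baseNext s (point s n) (vortexX s (n + 2)) = point s (n - 7) := by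
  have := baseNext_vortexX_add_two (s := s) (n * quarter s)
  rw [residue_mul_quarter] at this
  exact this.trans (congrArg Sum.inl (by push_cast; ring))

theorem baseNext_point_add_seven (hs : 2 ≤ s) (n : ℤ) :
    baseNext s (point s n) (point s (n + 7)) = vortexX s n :=
  (baseNext_seven hs (by push_cast; ring)).trans (by rw [residue_mul_quarter])

theorem baseNext_point_sub_eight (hs : 2 ≤ s) (n : ℤ) :
    baseNext s (point s n) (point s (n - 8)) = vortexX s (n + 1) :=
  (baseNext_neg_eight hs (by push_cast; ring)).trans (by rw [residue_mul_quarter])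

theorem baseNext_point_sub_two (hs : 2 ≤ s) (n : ℤ) :
    baseNext s (point s n) (point s (n - 2)) = vortexX s (n + 2) :=
  (baseNext_neg_two hs (by push_cast; ring)).trans (by rw [residue_mul_quarter])

/-- Handles links of the log that bypass the vortices. Only the offsets `-1`, `-3` and `4` are
needed: with the links through vortices, they join the arcs. -/
theorem baseNext_point_of_logStep (hs : 2 ≤ s) (n i k : ℤ) (hi : |i| < 19)
    (h : logStep s (i * quarter s) = k * quarter s)
    (h1 : i ≠ 1) (h2 : i ≠ 2) (h3 : i ≠ 7) (h4 : i ≠ -8) (h5 : i ≠ -2) :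
    baseNext s (point s n) (point s (n + i)) = point s (n + k) := by
  have e : ((n + i : ℤ) : ZMod (12 * s + 3)) * quarter s - n * quarter s = i * quarter s := by
    push_cast; ring
  have key : ∀ j : ℤ, i ≠ j → |j| < 9 → (i * quarter s : ZMod (12 * s + 3)) ≠ j * quarter s :=
    fun j hj hj' => mul_quarter_ne hs i j (sub_ne_zero.2 hj)
      ((abs_sub i j).trans_lt (by linarith))
  have g1 := key 1 h1 (by norm_num)
  have g2 := key 2 h2 (by norm_num)
  have g3 := key 7 h3 (by norm_num)
  have g4 := key (-8) h4 (by norm_num)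
  have g5 := key (-2) h5 (by norm_num)
  push_cast at g1 g2 g3 g4 g5
  rw [one_mul] at g1
  refine (baseNext_step (by rwa [e]) (by rwa [e]) (by rwa [e]) (by rwa [e]) (by rwa [e])).trans ?_
  rw [e, h]
  exact congrArg Sum.inl (by push_cast; ring)

theorem baseNext_point_sub_one (hs : 2 ≤ s) (n : ℤ) :
    baseNext s (point s n) (point s (n - 1)) = point s (n + 3) :=
  baseNext_point_of_logStep hs n (-1) 3 (by norm_num)
    (logStep_mul_quarter 1 0 (logNext.eq_nine_mul_add_two hs rfl) (by omega) (by push_cast; ring)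
      (by push_cast; ring))
    (by norm_num) (by norm_num) (by norm_num) (by norm_num) (by norm_num)

theorem baseNext_point_sub_three (hs : 2 ≤ s) (n : ℤ) :
    baseNext s (point s n) (point s (n - 3)) = point s (n - 4) :=
  baseNext_point_of_logStep hs n (-3) (-4) (by norm_num)
    (logStep_mul_quarter 1 2 (logNext.eq_three_mul hs rfl) (by omega) (by push_cast; ring)
      (by push_cast; ring))
    (by norm_num) (by norm_num) (by norm_num) (by norm_num) (by norm_num)

theorem baseNext_point_add_four (hs : 2 ≤ s) (n : ℤ) :
    baseNext s (point s n) (point s (n + 4)) = point s (n + 1) :=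
  baseNext_point_of_logStep hs n 4 1 (by norm_num)
    (logStep_mul_quarter (-1) 0 (logNext.eq_one rfl) (by omega) (by push_cast; ring)
      (by push_cast; ring))
    (by norm_num) (by norm_num) (by norm_num) (by norm_num) (by norm_num)

end Points

/-! ### The surgery as a finite table on eleven labels. -/

section Corners

/-- The corners of a list of oriented triangles: `(a, b, c)` stands for the corner at `b` between
`a` and its successor `c`. -/
def cornersOf {α : Type*} (l : List (α × α × α)) : List (α × α × α) :=
  l.flatMap fun t => [t, (t.2.1, t.2.2, t.1), (t.2.2, t.1, t.2.1)]

/-- The corner at `i` that begins with `j`, if there is one. -/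
def nextIn {α : Type*} [DecidableEq α] (l : List (α × α × α)) (i j : α) : Option α :=
  (l.find? fun t => t.2.1 = i ∧ t.1 = j).map fun t => t.2.2

/-- The triangles of the base embedding that are removed.  The labels of the vertices are those of
`special`. -/
def removedTriangles : List (Fin 11 × Fin 11 × Fin 11) :=
  [(8, 4, 2), (0, 1, 2), (9, 0, 4), (7, 0, 3), (7, 2, 4), (6, 0, 5), (8, 5, 1), (6, 4, 1),
    (3, 0, 10), (6, 5, 3)]

/-- The corners of the triangles of the base embedding that are removed. -/
def removedCorners : List (Fin 11 × Fin 11 × Fin 11) :=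
  cornersOf removedTriangles

/-- The corners of the new triangles and of the pentagon `0, 1, 8, 10, 7`. -/
def newCorners : List (Fin 11 × Fin 11 × Fin 11) :=
  [(0, 1, 8), (1, 8, 10), (8, 10, 7), (10, 7, 0), (7, 0, 1)] ++
  cornersOf [(2, 8, 7), (4, 9, 8), (0, 4, 2), (2, 4, 1), (0, 10, 9), (0, 3, 6), (3, 7, 10),
    (4, 7, 6), (0, 5, 3), (5, 6, 8), (1, 6, 5), (6, 7, 9), (6, 9, 10), (6, 10, 8), (7, 8, 9)]

/-- The labels of the vertices of the pentagon. -/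
def pentagonLabel : ZMod 5 → Fin 11 := ![0, 1, 8, 10, 7]

/-- A corner at `i` beginning with `j` stands for the face side from `j` to `i`. This lemma and the
next two say that the sides of the new faces are precisely those of the removed triangles together
with both directions of each edge between vortices. -/
theorem nextIn_removed_ne_none (i j k : Fin 11) (h : nextIn newCorners i j = some k) :
    nextIn removedCorners i j ≠ none ∨ (6 ≤ i ∧ 6 ≤ j) := by
  revert i j k; decide +kernel

theorem nextIn_new_ne_none (i j : Fin 11) (h : nextIn removedCorners i j ≠ none) :
    nextIn newCorners i j ≠ none := by
  revert i j; decide +kernel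

theorem nextIn_new_ne_none_of_vortex (i j : Fin 11) (hi : 6 ≤ i) (hj : 6 ≤ j) (hij : i ≠ j) :
    nextIn newCorners i j ≠ none := by
  revert i j; decide +kernel

theorem nextIn_new_triangle (i j k : Fin 11) (h : nextIn newCorners i j = some k)
    (hp : ∀ l, ¬(j = pentagonLabel l ∧ i = pentagonLabel (l + 1))) :
    nextIn newCorners k i = some j ∧ k ≠ i ∧
      ∀ l, ¬(i = pentagonLabel l ∧ k = pentagonLabel (l + 1)) := by
  revert i j k; decide +kernel

theorem nextIn_new_ne (i j k : Fin 11) (h : nextIn newCorners i j = some k) : k ≠ i := by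
  revert i j k; decide +kernel

theorem nextIn_removed_triangle (i j k : Fin 11) (h : nextIn removedCorners i j = some k) :
    nextIn removedCorners k i = some j := by
  revert i j k; decide +kernel

theorem nextIn_pentagon (l : ZMod 5) :
    nextIn newCorners (pentagonLabel (l + 1)) (pentagonLabel l) = some (pentagonLabel (l + 2)) := by
  revert l; decide +kernel

theorem pentagonLabel_injective : Function.Injective pentagonLabel := by decide +kernel

end Corners

end CurrentGraph

namespace CurrentGraph

variable {s : ℕ}

/-! ### Placing the table in the base embedding. -/

section Special

variable (s) in
/-- The vertices that are incident with removed or new faces. -/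
def special : Fin 11 → Vertex s :=
  ![point s 0, point s 1, point s 4, point s (-2), point s 2, point s (-1), vortexA s, vortexB s,
    vortexX s 0, vortexX s 1, vortexX s 2]

/-- The positions of the special vertices that are not vortices. -/
def position : Fin 11 → ℤ := ![0, 1, 4, -2, 2, -1, 0, 0, 0, 0, 0]

theorem special_eq_point {i : Fin 11} (hi : i < 6) : special s i = point s (position i) := by
  fin_cases i <;> first | rfl | exact absurd hi (by decide)

theorem exists_special_eq_inr (y : Bool ⊕ ZMod 3) : ∃ i, 6 ≤ i ∧ special s i = .inr y := by
  rcases y with (_ | _) | y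
  · exact ⟨6, le_rfl, rfl⟩
  · exact ⟨7, by decide, rfl⟩
  · obtain rfl | rfl | rfl : y = 0 ∨ y = 1 ∨ y = 2 := by revert y; decide
    · exact ⟨8, by decide, rfl⟩
    · exact ⟨9, by decide, rfl⟩
    · exact ⟨10, by decide, rfl⟩

theorem isLeft_special {i : Fin 11} : (special s i).isLeft ↔ i < 6 := by
  fin_cases i <;> first
    | exact ⟨fun _ => by decide, fun _ => rfl⟩
    | exact ⟨fun h => absurd h (by simp [special, vortexA, vortexB, vortexX]),
        fun h => absurd h (by decide)⟩

theorem special_injective (hs : 2 ≤ s) : Function.Injective (special s) := by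
  have hpos : ∀ i j : Fin 11, i < 6 → j < 6 → position i = position j → i = j := by decide
  have habs : ∀ i j : Fin 11, |position i - position j| < 27 := by decide
  intro i j h
  by_cases hi : i < 6
  · have hj : j < 6 := by rwa [← isLeft_special (s := s), ← h, isLeft_special]
    rw [special_eq_point hi, special_eq_point hj] at h
    exact hpos i j hi hj (point_injOn ((habs i j).trans_le (by omega)) h)
  · have hj : ¬j < 6 := by rwa [← isLeft_special (s := s), ← h, isLeft_special]
    revert h
    fin_cases i <;> first | exact absurd (by decide) hi | skip
    all_goals fin_cases j <;> first | exact absurd (by decide) hj | skip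
    all_goals first | exact fun _ => rfl | exact fun h => absurd (Sum.inr_injective h) (by decide)

theorem mem_of_nextIn {α : Type*} [DecidableEq α] {l : List (α × α × α)} {i j k : α}
    (h : nextIn l i j = some k) : (j, i, k) ∈ l := by
  obtain ⟨t, ht, rfl⟩ := Option.map_eq_some_iff.1 h
  have h1 := List.find?_some ht
  simp only [decide_eq_true_eq] at h1
  obtain ⟨rfl, rfl⟩ := h1
  exact List.mem_of_find?_eq_some ht

/-- One corner of each listed triangle is read off from the base rotation; the other two follow
because all base faces are triangles. -/
theorem baseNext_special_of_removed (hs : 2 ≤ s) {i j k : Fin 11}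
    (h : nextIn removedCorners i j = some k) :
    baseNext s (special s i) (special s j) = special s k := by
  have hb : ∀ t ∈ removedTriangles,
      baseNext s (special s t.2.1) (special s t.1) = special s t.2.2 := by
    simp only [removedTriangles, List.forall_mem_cons]
    exact ⟨baseNext_point_vortexX_add_one 2, baseNext_point_sub_one hs 1,
      baseNext_point_vortexX_add_one 0, baseNext_point_vortexB 0, baseNext_point_vortexB 4,
      baseNext_point_vortexA 0, baseNext_point_vortexX_add_one (-1), baseNext_point_vortexA 2,
      baseNext_point_sub_two hs 0, baseNext_point_vortexA (-1), by simp⟩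
  -- No removed triangle has two vortices on the sides used, so `baseNext_baseNext` applies.
  have hl : ∀ t ∈ removedTriangles, (t.1 ≠ t.2.1 ∧ t.2.1 ≠ t.2.2) ∧
      (t.1 < 6 ∨ t.2.1 < 6) ∧ (t.2.1 < 6 ∨ t.2.2 < 6) := by
    decide +kernel
  have hm := mem_of_nextIn h
  obtain ⟨t, ht, hm⟩ := List.mem_flatMap.1 hm
  have h1 := hb t ht
  obtain ⟨⟨n1, n2⟩, l1, l2⟩ := hl t ht
  have h2 := baseNext_baseNext hs ((special_injective hs).ne n1)
    (by rwa [isLeft_special, isLeft_special])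
  rw [h1] at h2
  have h3 := baseNext_baseNext hs ((special_injective hs).ne n2)
    (by rwa [isLeft_special, isLeft_special])
  rw [h2] at h3
  simp only [List.mem_cons, List.not_mem_nil, or_false] at hm
  rcases hm with rfl | hm | hm
  · exact h1
  · obtain ⟨rfl, rfl, rfl⟩ : j = t.2.1 ∧ i = t.2.2 ∧ k = t.1 := by simpa using hm
    exact h2
  · obtain ⟨rfl, rfl, rfl⟩ : j = t.2.2 ∧ i = t.1 ∧ k = t.2.1 := by simpa using hm
    exact h3

end Special

/-! ### The modified rotation and its faces. -/

section ModNext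

open Classical in
/-- The rotation obtained from the base embedding by replacing the removed triangles by the new
faces. -/
noncomputable def modNext (s : ℕ) (u v : Vertex s) : Vertex s :=
  if h : ∃ k i j, special s i = u ∧ special s j = v ∧ nextIn newCorners i j = some k then
    special s h.choose
  else baseNext s u v

theorem modNext_special (hs : 2 ≤ s) {i j k : Fin 11} (h : nextIn newCorners i j = some k) :
    modNext s (special s i) (special s j) = special s k := by
  have hex : ∃ k i' j', special s i' = special s i ∧ special s j' = special s j ∧
    nextIn newCorners i' j' = some k := ⟨k, i, j, rfl, rfl, h⟩
  obtain ⟨i', j', hi, hj, hk⟩ := hex.choose_spec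
  rw [special_injective hs hi, special_injective hs hj, h] at hk
  rw [modNext, dif_pos hex, ← Option.some_injective _ hk]

theorem modNext_eq_baseNext {u v : Vertex s}
    (h : ∀ i j, special s i = u → special s j = v → nextIn newCorners i j = none) :
    modNext s u v = baseNext s u v := by
  refine dif_neg ?_
  rintro ⟨k, i, j, hi, hj, hk⟩
  rw [h i j hi hj] at hk
  exact Option.some_ne_none k hk.symm

/-- Either a corner is new or it is a corner of the base embedding. -/
theorem modNext_cases (hs : 2 ≤ s) {u v : Vertex s} (huv : u ≠ v) :
    (∃ i j k, special s i = u ∧ special s j = v ∧ nextIn newCorners i j = some k ∧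
      modNext s u v = special s k) ∨
    ((∀ i j, special s i = u → special s j = v → nextIn newCorners i j = none) ∧
      modNext s u v = baseNext s u v ∧ (u.isLeft ∨ v.isLeft)) := by
  by_cases h : ∀ i j, special s i = u → special s j = v → nextIn newCorners i j = none
  · refine .inr ⟨h, modNext_eq_baseNext h, ?_⟩
    rcases u with u | u
    · exact .inl rfl
    rcases v with v | v
    · exact .inr rfl
    obtain ⟨i, hi, hi'⟩ := exists_special_eq_inr (s := s) u
    obtain ⟨j, hj, hj'⟩ := exists_special_eq_inr (s := s) v
    refine absurd (h i j hi' hj') (nextIn_new_ne_none_of_vortex i j hi hj ?_)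
    rintro rfl
    exact huv (hi'.symm.trans hj')
  · push Not at h
    obtain ⟨i, j, rfl, rfl, h⟩ := h
    obtain ⟨k, hk⟩ := Option.ne_none_iff_exists'.1 h
    exact .inl ⟨i, j, k, rfl, rfl, hk, modNext_special hs hk⟩

theorem modNext_ne (hs : 2 ≤ s) (u v : Vertex s) (huv : u ≠ v) : modNext s u v ≠ u := by
  obtain ⟨i, j, k, rfl, rfl, hk, e⟩ | ⟨-, e, hl⟩ := modNext_cases hs huv
  · rw [e]
    exact (special_injective hs).ne (nextIn_new_ne i j k hk)
  · rw [e]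
    exact baseNext_ne hs huv hl

/-- The predecessor of an unchanged corner in its face is unchanged. -/
theorem nextIn_baseNext (hs : 2 ≤ s) {u v : Vertex s} (huv : u ≠ v) (hl : u.isLeft ∨ v.isLeft)
    (h : ∀ i j, special s i = u → special s j = v → nextIn newCorners i j = none) :
    ∀ i j, special s i = baseNext s u v → special s j = u → nextIn newCorners i j = none := by
  intro i j hi hj
  by_contra hne
  obtain ⟨k, hk⟩ := Option.ne_none_iff_exists'.1 hne
  have hb := baseNext_baseNext hs huv.symm hl.symm
  -- If the corner was removed, its whole triangle was, so the corner at `u` beginning with `v`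
  -- would be new as well. If it joins two vortices, then `u` is a vortex whose base successors are
  -- group elements.
  obtain hr | ⟨h6i, h6j⟩ := nextIn_removed_ne_none i j k hk
  · obtain ⟨k', hk'⟩ := Option.ne_none_iff_exists'.1 hr
    have h1 := baseNext_special_of_removed hs hk'
    rw [hi, hj, hb] at h1
    have h2 := nextIn_removed_triangle _ _ _ (nextIn_removed_triangle _ _ _ hk')
    exact nextIn_new_ne_none j k' (by rw [h2]; simp) (h j k' hj h1.symm)
  · have hu : ¬u.isLeft := by rw [← hj, isLeft_special]; exact not_lt.2 h6j
    have hw : ¬(baseNext s u v).isLeft := by rw [← hi, isLeft_special]; exact not_lt.2 h6i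
    rcases u with u | u
    · exact hu rfl
    rcases v with v | v
    · refine hw ?_
      rcases u with (_ | _) | u
      · rfl
      · rfl
      · simp only [baseNext]; split_ifs <;> rfl
    · simp at hl

variable (s) in
/-- The vertices of the pentagon. -/
def pentagon (l : ZMod 5) : Vertex s := special s (pentagonLabel l)

theorem modNext_triangle (hs : 2 ≤ s) (u v : Vertex s) (huv : u ≠ v)
    (hp : ∀ l, ¬(u = pentagon s l ∧ v = pentagon s (l + 1))) :
    modNext s (modNext s v u) v = u := by
  obtain ⟨i, j, k, rfl, rfl, hk, e⟩ | ⟨h, e, hl⟩ := modNext_cases hs huv.symm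
  · rw [e]
    exact modNext_special hs (nextIn_new_triangle i j k hk fun l hl => hp l
      ⟨congrArg _ hl.1, congrArg _ hl.2⟩).1
  · rw [e, modNext_eq_baseNext (nextIn_baseNext hs huv.symm hl h)]
    exact baseNext_baseNext hs huv hl.symm

theorem modNext_closed (hs : 2 ≤ s) (u v : Vertex s) (huv : u ≠ v)
    (hp : ∀ l, ¬(u = pentagon s l ∧ v = pentagon s (l + 1))) (l : ZMod 5) :
    ¬(v = pentagon s l ∧ modNext s v u = pentagon s (l + 1)) := by
  obtain ⟨i, j, k, rfl, rfl, hk, e⟩ | ⟨h, e, hl⟩ := modNext_cases hs huv.symm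
  · rw [e]
    rintro ⟨h1, h2⟩
    exact (nextIn_new_triangle i j k hk fun l hl => hp l
      ⟨congrArg _ hl.1, congrArg _ hl.2⟩).2.2 l
      ⟨special_injective hs h1, special_injective hs h2⟩
  · rw [e]
    rintro ⟨h1, h2⟩
    -- The next corner in this face is unchanged, whereas the corners of the pentagon are all new.
    have := nextIn_baseNext hs huv.symm hl h _ _ h2.symm h1.symm
    rw [nextIn_pentagon] at this
    exact Option.some_ne_none _ this

end ModNext

end CurrentGraph

namespace CurrentGraph

variable {s : ℕ}

/-! ### Rows of group elements. -/

section Rows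

theorem zmod_three_eq : ∀ x : ZMod 3, x = 0 ∨ x = 1 ∨ x = 2 := by decide

theorem iff_add_mul {p : ℤ → Prop} {d : ℤ} (h : ∀ n, p n ↔ p (n + d)) (n k : ℤ) :
    p n ↔ p (n + d * k) := by
  induction k with
  | zero => simp
  | succ k ih => rw [ih, h]; ring_nf
  | pred k ih => rw [ih, h (n + d * (-k - 1))]; ring_nf

/-- The links of a row that do not meet the special vertices connect the remaining neighbours. -/
theorem baseNext_segments (hs : 2 ≤ s) (n : ℤ) (P : Vertex s → Prop)
    (hP : ∀ v, (∀ k ∈ [0, 4, -3, 1, -2, 2, -1, 7, -8], Sum.inl v ≠ point s (n + k)) →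
      (P (.inl v) ↔ P (baseNext s (point s n) (.inl v)))) :
    ((P (point s (n + 8)) ↔ P (point s (n + 4))) ∧ (P (point s (n + 3)) ↔ P (point s (n - 8))) ∧
      (P (point s (n - 7)) ↔ P (point s (n - 3))) ∧
      (P (point s (n - 4)) ↔ P (point s (n + 7)))) ∧
    ∀ b : Prop, (∀ k ∈ [4, -3, 1, -2, 2, -1, 3, -4], (P (point s (n + k)) ↔ b)) →
      ∀ v, Sum.inl v ≠ point s n → (P (.inl v) ↔ b) := by
  have hpt : ∀ (a : ℕ) (k j : ℤ), (a : ℤ) = k * (3 * s + 1) + j * (12 * s + 3) →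
      (Sum.inl (n * quarter s + a) : Vertex s) = point s (n + k) := by
    intro a k j h
    rw [natCast_eq_mul_quarter j h]
    exact congrArg Sum.inl (by push_cast; ring)
  have hmod : ∀ a : ℕ, a < 12 * s + 3 → ∀ (c : ℕ) (k j : ℤ),
      (c : ℤ) = k * (3 * s + 1) + j * (12 * s + 3) → c < 12 * s + 3 → a ≠ c →
      (a : ZMod (12 * s + 3)) ≠ k * quarter s :=
    fun a ha c k j h hc hne => natCast_ne_mul_quarter j h hc ha hne
  obtain ⟨⟨h1, h2, h3, h4⟩, h⟩ := logNext_segments hs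
    (fun a => P (.inl (n * quarter s + a))) (by
      intro a h0 hm h1 h2 h3 h4 h5 h6 h7 h8
      have g1 := hmod a hm (3 * s + 1) 1 0 (by push_cast; ring) (by omega) h3
      have g2 := hmod a hm (6 * s + 2) 2 0 (by push_cast; ring) (by omega) h5
      have g3 := hmod a hm (9 * s + 4) 7 (-1) (by push_cast; ring) (by omega) h7
      have g4 := hmod a hm (12 * s + 1) (-8) 3 (by push_cast; ring) (by omega) h8
      have g5 := hmod a hm (6 * s + 1) (-2) 1 (by push_cast; ring) (by omega) h4
      have g6 := hmod a hm 1 4 (-1) (by push_cast; ring) (by omega) h1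
      have g7 := hmod a hm (3 * s) (-3) 1 (by push_cast; ring) (by omega) h2
      have g8 := hmod a hm (9 * s + 2) (-1) 1 (by push_cast; ring) (by omega) h6
      have g0 := hmod a hm 0 0 0 (by push_cast; ring) (by omega) (by omega)
      have e : n * quarter s + a - n * quarter s = (a : ZMod (12 * s + 3)) := by ring
      refine (hP _ ?_).trans ?_
      · have key : ∀ k : ℤ, (a : ZMod (12 * s + 3)) ≠ k * quarter s →
            (Sum.inl (n * quarter s + a) : Vertex s) ≠ point s (n + k) := by
          intro k hk hp
          apply hk
          have := Sum.inl_injective hp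
          push_cast at this
          linear_combination this
        simp only [List.forall_mem_cons]
        exact ⟨key _ g0, key _ g6, key _ g7, key _ g1, key _ g5, key _ g2, key _ g8, key _ g3,
          key _ g4, by simp⟩
      · push_cast at g1 g2 g3 g4 g5
        rw [one_mul] at g1
        refine iff_of_eq (congrArg P ?_)
        refine (baseNext_step (by rwa [e]) (by rwa [e]) (by rwa [e]) (by rwa [e])
          (by rwa [e])).trans ?_
        rw [e, logStep, ZMod.val_natCast_of_lt hm])
  simp only [hpt 2 8 (-2) (by push_cast; ring), hpt 1 4 (-1) (by push_cast; ring),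
    hpt (9 * s + 3) 3 0 (by push_cast; ring), hpt (12 * s + 1) (-8) 3 (by push_cast; ring),
    hpt (3 * s - 1) (-7) 2 (by push_cast [show 1 ≤ 3 * s by omega]; ring),
    hpt (3 * s) (-3) 1 (by push_cast; ring), hpt (12 * s + 2) (-4) 2 (by push_cast; ring),
    hpt (9 * s + 4) 7 (-1) (by push_cast; ring), hpt (3 * s + 1) 1 0 (by push_cast; ring),
    hpt (6 * s + 1) (-2) 1 (by push_cast; ring), hpt (6 * s + 2) 2 0 (by push_cast; ring),
    hpt (9 * s + 2) (-1) 1 (by push_cast; ring)] at h1 h2 h3 h4 h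
  refine ⟨⟨h1, h2, h3, h4⟩, fun b hb v hv => ?_⟩
  simp only [List.forall_mem_cons] at hb
  obtain ⟨b1, b2, b3, b4, b5, b6, b7, b8, -⟩ := hb
  have := h b b1 b2 b3 b4 b5 b6 b7 b8 (v - n * quarter s).val
    (Nat.pos_of_ne_zero fun h0 => hv ?_) (ZMod.val_lt _)
  · rwa [ZMod.natCast_zmod_val, add_sub_cancel] at this
  · rw [ZMod.val_eq_zero, sub_eq_zero] at h0
    rw [h0]; rfl

/-- The listed offsets are the position differences of special points that meet at a new corner, so
one list serves every row. -/
theorem modNext_point_eq_baseNext (n : ℤ) (v : ZMod (12 * s + 3))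
    (h : ∀ k ∈ [4, -3, 1, -2, 2, -1], Sum.inl v ≠ point s (n + k)) :
    modNext s (point s n) (.inl v) = baseNext s (point s n) (.inl v) := by
  have hd : ∀ i j : Fin 11, i < 6 → j < 6 → nextIn newCorners i j ≠ none →
      position j - position i ∈ [4, -3, 1, -2, 2, -1] := by decide +kernel
  refine modNext_eq_baseNext fun i j hi hj => ?_
  have hi6 : i < 6 := isLeft_special.1 (by rw [hi]; rfl)
  have hj6 : j < 6 := isLeft_special.1 (by rw [hj]; rfl)
  by_contra hne
  refine h _ (hd i j hi6 hj6 hne) ?_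
  rw [special_eq_point hi6] at hi
  rw [← hj, special_eq_point hj6]
  have := Sum.inl_injective hi
  refine congrArg Sum.inl ?_
  push_cast
  linear_combination this

variable {P : Vertex s → Prop}

/-- The arcs of the log avoid all changed corners, so cyclicity needs only the links between their
ends and the vortices, a task whose size does not depend on `s`. Two arcs end at offsets `7` and
`-8`, are also unchanged there, and hence run on into `X n` and `X (n + 1)`. The truth value at `A`
serves as reference. -/
theorem iff_of_links (hs : 2 ≤ s) (n : ℤ)
    (hP : ∀ v, v ≠ point s n → (P v ↔ P (modNext s (point s n) v)))
    (h : (P (point s (n + 8)) ↔ P (point s (n + 4))) →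
      (P (point s (n + 3)) ↔ P (vortexX s (n + 1))) →
      (P (point s (n - 7)) ↔ P (point s (n - 3))) → (P (point s (n - 4)) ↔ P (vortexX s n)) →
      (∀ k ∈ [4, -3, 1, -2, 2, -1, 3, -4], (P (point s (n + k)) ↔ P (vortexA s))) ∧
        (P (vortexB s) ↔ P (vortexA s)) ∧ ∀ i : ZMod 3, P (vortexX s (n + i)) ↔ P (vortexA s))
    (v : Vertex s) (hv : v ≠ point s n) : P v ↔ P (vortexA s) := by
  have hb : ∀ v, (∀ k ∈ [4, -3, 1, -2, 2, -1], Sum.inl v ≠ point s (n + k)) →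
      Sum.inl v ≠ point s n → (P (.inl v) ↔ P (baseNext s (point s n) (.inl v))) := by
    intro v hv h0
    rw [hP _ h0, modNext_point_eq_baseNext n v hv]
  have hne : ∀ a b : ℤ, a - b ≠ 0 → |a - b| < 27 → point s (n + a) ≠ point s (n + b) := by
    intro a b h1 h2 e
    have := point_injOn (s := s) (by rw [add_sub_add_left_eq_sub]; omega) e
    omega
  have hb' : ∀ a : ℤ, |a| < 20 → a ∉ [0, 4, -3, 1, -2, 2, -1] →
      (P (point s (n + a)) ↔ P (baseNext s (point s n) (point s (n + a)))) := by
    intro a h1 h2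
    rw [abs_lt] at h1
    simp only [List.mem_cons, not_or] at h2
    refine hb _ ?_ ?_
    · simp only [List.forall_mem_cons]
      refine ⟨hne _ _ ?_ ?_, hne _ _ ?_ ?_, hne _ _ ?_ ?_, hne _ _ ?_ ?_, hne _ _ ?_ ?_,
        hne _ _ ?_ ?_, by simp⟩ <;> first | (rw [abs_lt]; omega) | omega
    · have := hne a 0 (by omega) (by rw [abs_lt]; omega)
      rwa [add_zero] at this
  obtain ⟨⟨h1, h2, h3, h4⟩, hseg⟩ := baseNext_segments hs n P fun v hv => by
    simp only [List.forall_mem_cons, add_zero] at hv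
    obtain ⟨k0, k1, k2, k3, k4, k5, k6, -⟩ := hv
    exact hb v (by simpa using ⟨k1, k2, k3, k4, k5, k6⟩) k0
  have h7 := hb' 7 (by norm_num) (by decide)
  have h8 := hb' (-8) (by norm_num) (by decide)
  rw [baseNext_point_add_seven hs] at h7
  rw [← sub_eq_add_neg, baseNext_point_sub_eight hs] at h8
  obtain ⟨g, gB, gX⟩ := h h1 (h2.trans h8) h3 (h4.trans h7)
  rcases v with v | (_ | _) | i
  · exact hseg _ g v hv
  · exact Iff.rfl
  · exact gB
  · have := gX (i - n)
    rwa [add_sub_cancel] at this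

theorem modNext_special_point_eq_baseNext (hs : 2 ≤ s) {i : Fin 11} (q : ℤ) (hq : |q| < 20)
    (h : ∀ j < 6, position j = q → nextIn newCorners i j = none) :
    modNext s (special s i) (point s q) = baseNext s (special s i) (point s q) := by
  have hpos : ∀ j, |position j| < 5 := by decide
  refine modNext_eq_baseNext fun i' j hi hj => ?_
  rw [special_injective hs hi]
  have hj6 : j < 6 := isLeft_special.1 (by rw [hj]; rfl)
  rw [special_eq_point hj6] at hj
  refine h j hj6 (point_injOn (s := s) ?_ hj)
  have := abs_lt.1 (hpos j)
  rw [abs_lt] at hq ⊢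
  omega

theorem modNext_special_special_eq_baseNext (hs : 2 ≤ s) {i j : Fin 11}
    (h : nextIn newCorners i j = none) :
    modNext s (special s i) (special s j) = baseNext s (special s i) (special s j) := by
  refine modNext_eq_baseNext fun i' j' hi hj => ?_
  rw [special_injective hs hi, special_injective hs hj, h]

theorem iff_of_nextIn (hs : 2 ≤ s) {i : Fin 11}
    (hP : ∀ v, v ≠ special s i → (P v ↔ P (modNext s (special s i) v))) {j k : Fin 11}
    (h : nextIn newCorners i j = some k) (hij : i ≠ j := by decide) :
    P (special s j) ↔ P (special s k) := by
  rw [hP _ ((special_injective hs).ne hij.symm), modNext_special hs h]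

/-- The default argument is the finite check that the table leaves this corner alone and that the
neighbour differs from the vertex itself. -/
theorem iff_of_baseNext_point (hs : 2 ≤ s) {i : Fin 11}
    (hP : ∀ v, v ≠ special s i → (P v ↔ P (modNext s (special s i) v))) {q : ℤ} {x : Vertex s}
    (hx : baseNext s (special s i) (point s q) = x)
    (h : |q| < 20 ∧ ∀ j < 6, (position j = q → nextIn newCorners i j = none ∧ j ≠ i) :=
      by decide +kernel) :
    P (point s q) ↔ P x := by
  have hne : point s q ≠ special s i := by
    intro e
    have hi : i < 6 := isLeft_special.1 (by rw [← e]; rfl)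
    rw [special_eq_point hi] at e
    have hpos : ∀ j, |position j| < 5 := by decide
    have h5 := abs_lt.1 (hpos i)
    have hq := abs_lt.1 h.1
    exact (h.2 i hi (point_injOn (s := s) (by rw [abs_lt]; omega) e).symm).2 rfl
  rw [hP _ hne, modNext_special_point_eq_baseNext hs q h.1 fun j hj hq => (h.2 j hj hq).1, hx]

theorem iff_of_baseNext_special (hs : 2 ≤ s) {i : Fin 11}
    (hP : ∀ v, v ≠ special s i → (P v ↔ P (modNext s (special s i) v))) {j : Fin 11}
    {x : Vertex s} (hx : baseNext s (special s i) (special s j) = x)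
    (h : nextIn newCorners i j = none ∧ i ≠ j := by decide +kernel) :
    P (special s j) ↔ P x := by
  rw [hP _ ((special_injective hs).ne h.2.symm), modNext_special_special_eq_baseNext hs h.1, hx]

/-- With dots for the arcs, the row of `0` is now `4, 2, B, 1, A, -2, -1, 3 … -8, X 1, X 2, -7 … -3,
-4 … 7, X 0, 8 …`. Each link is read from the table if it is new and from the base rotation
otherwise. The other five special points are treated alike. -/
theorem iff_vortexA_zero (hs : 2 ≤ s)
    (hP : ∀ v, v ≠ special s 0 → (P v ↔ P (modNext s (special s 0) v))) (v : Vertex s)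
    (hv : v ≠ special s 0) : P v ↔ P (vortexA s) := by
  refine iff_of_links hs 0 hP (fun f1 f2 f3 f4 => ?_) v hv
  -- The integer positions and the indices in `ZMod 3` are evaluated by definitional unfolding.
  replace f1 : P (point s 8) ↔ P (point s 4) := f1
  replace f2 : P (point s 3) ↔ P (vortexX s 1) := f2
  replace f3 : P (point s (-7)) ↔ P (point s (-3)) := f3
  replace f4 : P (point s (-4)) ↔ P (vortexX s 0) := f4
  have g0 : P (point s 4) ↔ P (point s 2) := iff_of_nextIn hs hP (j := 2) (k := 4) rfl
  have g1 : P (point s (-3)) ↔ P (point s (-4)) :=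
    iff_of_baseNext_point hs hP (baseNext_point_sub_three hs 0)
  have g2 : P (point s 1) ↔ P (vortexA s) :=
    iff_of_baseNext_point hs hP (baseNext_point_add_one 0)
  have g3 : P (vortexA s) ↔ P (point s (-2)) := iff_of_nextIn hs hP (j := 6) (k := 3) rfl
  have g4 : P (point s (-1)) ↔ P (point s 3) :=
    iff_of_baseNext_point hs hP (baseNext_point_sub_one hs 0)
  have g5 : P (point s 2) ↔ P (vortexB s) :=
    iff_of_baseNext_point hs hP (baseNext_point_add_two hs 0)
  have g6 : P (vortexB s) ↔ P (point s 1) := iff_of_nextIn hs hP (j := 7) (k := 1) rfl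
  have g7 : P (point s (-2)) ↔ P (point s (-1)) := iff_of_nextIn hs hP (j := 3) (k := 5) rfl
  have g8 : P (vortexX s 0) ↔ P (point s 8) :=
    iff_of_baseNext_special hs hP (j := 8) (baseNext_point_vortexX 0)
  have g9 : P (vortexX s 1) ↔ P (vortexX s 2) := iff_of_nextIn hs hP (j := 9) (k := 10) rfl
  have g10 : P (vortexX s 2) ↔ P (point s (-7)) :=
    iff_of_baseNext_special hs hP (j := 10) (baseNext_point_vortexX_add_two 0)
  have hX : ∀ x : ZMod 3, P (vortexX s x) ↔ P (vortexA s) := by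
    intro x
    obtain rfl | rfl | rfl := zmod_three_eq x <;> grind only
  have hB : P (vortexB s) ↔ P (vortexA s) := by grind only
  simp only [List.forall_mem_cons]
  refine ⟨⟨?_, ?_, ?_, ?_, ?_, ?_, ?_, ?_, by simp⟩, hB, fun x => hX _⟩
  · change P (point s 4) ↔ _; grind only
  · change P (point s (-3)) ↔ _; grind only
  · change P (point s 1) ↔ _; grind only
  · change P (point s (-2)) ↔ _; grind only
  · change P (point s 2) ↔ _; grind only
  · change P (point s (-1)) ↔ _; grind only
  · change P (point s 3) ↔ _; grind only
  · change P (point s (-4)) ↔ _; grind only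

theorem iff_vortexA_one (hs : 2 ≤ s)
    (hP : ∀ v, v ≠ special s 1 → (P v ↔ P (modNext s (special s 1) v))) (v : Vertex s)
    (hv : v ≠ special s 1) : P v ↔ P (vortexA s) := by
  refine iff_of_links hs 1 hP (fun f1 f2 f3 f4 => ?_) v hv
  replace f1 : P (point s 9) ↔ P (point s 5) := f1
  replace f2 : P (point s 4) ↔ P (vortexX s 2) := f2
  replace f3 : P (point s (-6)) ↔ P (point s (-2)) := f3
  replace f4 : P (point s (-3)) ↔ P (vortexX s 1) := f4
  have g0 : P (point s 5) ↔ P (point s 2) :=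
    iff_of_baseNext_point hs hP (baseNext_point_add_four hs 1)
  have g1 : P (point s (-2)) ↔ P (point s (-3)) :=
    iff_of_baseNext_point hs hP (baseNext_point_sub_three hs 1)
  have g2 : P (point s 2) ↔ P (point s 4) := iff_of_nextIn hs hP (j := 4) (k := 2) rfl
  have g3 : P (vortexA s) ↔ P (point s 0) :=
    iff_of_baseNext_special hs hP (j := 6) (baseNext_point_vortexA 1)
  have g4 : P (point s 0) ↔ P (vortexX s 0) := iff_of_nextIn hs hP (j := 0) (k := 8) rfl
  have g5 : P (point s 3) ↔ P (vortexB s) :=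
    iff_of_baseNext_point hs hP (baseNext_point_add_two hs 1)
  have g6 : P (vortexB s) ↔ P (point s (-1)) :=
    iff_of_baseNext_special hs hP (j := 7) (baseNext_point_vortexB 1)
  have g7 : P (point s (-1)) ↔ P (vortexA s) := iff_of_nextIn hs hP (j := 5) (k := 6) rfl
  have g8 : P (vortexX s 1) ↔ P (point s 9) :=
    iff_of_baseNext_special hs hP (j := 9) (baseNext_point_vortexX 1)
  have g9 : P (vortexX s 2) ↔ P (point s 3) :=
    iff_of_baseNext_special hs hP (j := 10) (baseNext_point_vortexX_add_one 1)
  have g10 : P (vortexX s 0) ↔ P (point s (-6)) :=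
    iff_of_baseNext_special hs hP (j := 8) (baseNext_point_vortexX_add_two 1)
  have hX : ∀ x : ZMod 3, P (vortexX s x) ↔ P (vortexA s) := by
    intro x
    obtain rfl | rfl | rfl := zmod_three_eq x <;> grind only
  have hB : P (vortexB s) ↔ P (vortexA s) := by grind only
  simp only [List.forall_mem_cons]
  refine ⟨⟨?_, ?_, ?_, ?_, ?_, ?_, ?_, ?_, by simp⟩, hB, fun x => hX _⟩
  · change P (point s 5) ↔ _; grind only
  · change P (point s (-2)) ↔ _; grind only
  · change P (point s 2) ↔ _; grind only
  · change P (point s (-1)) ↔ _; grind only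
  · change P (point s 3) ↔ _; grind only
  · change P (point s 0) ↔ _; grind only
  · change P (point s 4) ↔ _; grind only
  · change P (point s (-3)) ↔ _; grind only

theorem iff_vortexA_four (hs : 2 ≤ s)
    (hP : ∀ v, v ≠ special s 2 → (P v ↔ P (modNext s (special s 2) v))) (v : Vertex s)
    (hv : v ≠ special s 2) : P v ↔ P (vortexA s) := by
  refine iff_of_links hs 4 hP (fun f1 f2 f3 f4 => ?_) v hv
  replace f1 : P (point s 12) ↔ P (point s 8) := f1
  replace f2 : P (point s 7) ↔ P (vortexX s 2) := f2
  replace f3 : P (point s (-3)) ↔ P (point s 1) := f3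
  replace f4 : P (point s 0) ↔ P (vortexX s 1) := f4
  have g0 : P (point s 8) ↔ P (point s 5) :=
    iff_of_baseNext_point hs hP (baseNext_point_add_four hs 4)
  have g1 : P (point s 1) ↔ P (point s 2) := iff_of_nextIn hs hP (j := 1) (k := 4) rfl
  have g2 : P (point s 5) ↔ P (vortexA s) :=
    iff_of_baseNext_point hs hP (baseNext_point_add_one 4)
  have g3 : P (vortexA s) ↔ P (point s 3) :=
    iff_of_baseNext_special hs hP (j := 6) (baseNext_point_vortexA 4)
  have g4 : P (point s 3) ↔ P (point s 7) :=
    iff_of_baseNext_point hs hP (baseNext_point_sub_one hs 4)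
  have g5 : P (point s 6) ↔ P (vortexB s) :=
    iff_of_baseNext_point hs hP (baseNext_point_add_two hs 4)
  have g6 : P (vortexB s) ↔ P (vortexX s 0) := iff_of_nextIn hs hP (j := 7) (k := 8) rfl
  have g7 : P (point s 2) ↔ P (point s 0) := iff_of_nextIn hs hP (j := 4) (k := 0) rfl
  have g8 : P (vortexX s 1) ↔ P (point s 12) :=
    iff_of_baseNext_special hs hP (j := 9) (baseNext_point_vortexX 4)
  have g9 : P (vortexX s 2) ↔ P (point s 6) :=
    iff_of_baseNext_special hs hP (j := 10) (baseNext_point_vortexX_add_one 4)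
  have g10 : P (vortexX s 0) ↔ P (point s (-3)) :=
    iff_of_baseNext_special hs hP (j := 8) (baseNext_point_vortexX_add_two 4)
  have hX : ∀ x : ZMod 3, P (vortexX s x) ↔ P (vortexA s) := by
    intro x
    obtain rfl | rfl | rfl := zmod_three_eq x <;> grind only
  have hB : P (vortexB s) ↔ P (vortexA s) := by grind only
  simp only [List.forall_mem_cons]
  refine ⟨⟨?_, ?_, ?_, ?_, ?_, ?_, ?_, ?_, by simp⟩, hB, fun x => hX _⟩
  · change P (point s 8) ↔ _; grind only
  · change P (point s 1) ↔ _; grind only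
  · change P (point s 5) ↔ _; grind only
  · change P (point s 2) ↔ _; grind only
  · change P (point s 6) ↔ _; grind only
  · change P (point s 3) ↔ _; grind only
  · change P (point s 7) ↔ _; grind only
  · change P (point s 0) ↔ _; grind only

theorem iff_vortexA_neg_two (hs : 2 ≤ s)
    (hP : ∀ v, v ≠ special s 3 → (P v ↔ P (modNext s (special s 3) v))) (v : Vertex s)
    (hv : v ≠ special s 3) : P v ↔ P (vortexA s) := by
  refine iff_of_links hs (-2) hP (fun f1 f2 f3 f4 => ?_) v hv
  replace f1 : P (point s 6) ↔ P (point s 2) := f1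
  replace f2 : P (point s 1) ↔ P (vortexX s 2) := f2
  replace f3 : P (point s (-9)) ↔ P (point s (-5)) := f3
  replace f4 : P (point s (-6)) ↔ P (vortexX s 1) := f4
  have g0 : P (point s 2) ↔ P (point s (-1)) :=
    iff_of_baseNext_point hs hP (baseNext_point_add_four hs (-2))
  have g1 : P (point s (-5)) ↔ P (point s (-6)) :=
    iff_of_baseNext_point hs hP (baseNext_point_sub_three hs (-2))
  have g2 : P (point s (-1)) ↔ P (point s 0) := iff_of_nextIn hs hP (j := 5) (k := 0) rfl
  have g3 : P (vortexA s) ↔ P (point s (-3)) :=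
    iff_of_baseNext_special hs hP (j := 6) (baseNext_point_vortexA (-2))
  have g4 : P (point s (-3)) ↔ P (point s 1) :=
    iff_of_baseNext_point hs hP (baseNext_point_sub_one hs (-2))
  have g5 : P (point s 0) ↔ P (vortexA s) := iff_of_nextIn hs hP (j := 0) (k := 6) rfl
  have g6 : P (vortexB s) ↔ P (point s (-4)) :=
    iff_of_baseNext_special hs hP (j := 7) (baseNext_point_vortexB (-2))
  have g7 : P (point s (-4)) ↔ P (vortexX s 0) :=
    iff_of_baseNext_point hs hP (baseNext_point_sub_two hs (-2))
  have g8 : P (vortexX s 1) ↔ P (point s 6) :=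
    iff_of_baseNext_special hs hP (j := 9) (baseNext_point_vortexX (-2))
  have g9 : P (vortexX s 2) ↔ P (vortexB s) := iff_of_nextIn hs hP (j := 10) (k := 7) rfl
  have g10 : P (vortexX s 0) ↔ P (point s (-9)) :=
    iff_of_baseNext_special hs hP (j := 8) (baseNext_point_vortexX_add_two (-2))
  have hX : ∀ x : ZMod 3, P (vortexX s x) ↔ P (vortexA s) := by
    intro x
    obtain rfl | rfl | rfl := zmod_three_eq x <;> grind only
  have hB : P (vortexB s) ↔ P (vortexA s) := by grind only
  simp only [List.forall_mem_cons]
  refine ⟨⟨?_, ?_, ?_, ?_, ?_, ?_, ?_, ?_, by simp⟩, hB, fun x => hX _⟩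
  · change P (point s 2) ↔ _; grind only
  · change P (point s (-5)) ↔ _; grind only
  · change P (point s (-1)) ↔ _; grind only
  · change P (point s (-4)) ↔ _; grind only
  · change P (point s 0) ↔ _; grind only
  · change P (point s (-3)) ↔ _; grind only
  · change P (point s 1) ↔ _; grind only
  · change P (point s (-6)) ↔ _; grind only

theorem iff_vortexA_two (hs : 2 ≤ s)
    (hP : ∀ v, v ≠ special s 4 → (P v ↔ P (modNext s (special s 4) v))) (v : Vertex s)
    (hv : v ≠ special s 4) : P v ↔ P (vortexA s) := by
  refine iff_of_links hs 2 hP (fun f1 f2 f3 f4 => ?_) v hv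
  replace f1 : P (point s 10) ↔ P (point s 6) := f1
  replace f2 : P (point s 5) ↔ P (vortexX s 0) := f2
  replace f3 : P (point s (-5)) ↔ P (point s (-1)) := f3
  replace f4 : P (point s (-2)) ↔ P (vortexX s 2) := f4
  have g0 : P (point s 6) ↔ P (point s 3) :=
    iff_of_baseNext_point hs hP (baseNext_point_add_four hs 2)
  have g1 : P (point s (-1)) ↔ P (point s (-2)) :=
    iff_of_baseNext_point hs hP (baseNext_point_sub_three hs 2)
  have g2 : P (point s 3) ↔ P (vortexA s) :=
    iff_of_baseNext_point hs hP (baseNext_point_add_one 2)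
  have g3 : P (vortexA s) ↔ P (vortexB s) := iff_of_nextIn hs hP (j := 6) (k := 7) rfl
  have g4 : P (point s 1) ↔ P (point s 5) :=
    iff_of_baseNext_point hs hP (baseNext_point_sub_one hs 2)
  have g5 : P (point s 4) ↔ P (point s 1) := iff_of_nextIn hs hP (j := 2) (k := 1) rfl
  have g6 : P (vortexB s) ↔ P (point s 0) :=
    iff_of_baseNext_special hs hP (j := 7) (baseNext_point_vortexB 2)
  have g7 : P (point s 0) ↔ P (point s 4) := iff_of_nextIn hs hP (j := 0) (k := 2) rfl
  have g8 : P (vortexX s 2) ↔ P (point s 10) :=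
    iff_of_baseNext_special hs hP (j := 10) (baseNext_point_vortexX 2)
  have g9 : P (vortexX s 0) ↔ P (vortexX s 1) := iff_of_nextIn hs hP (j := 8) (k := 9) rfl
  have g10 : P (vortexX s 1) ↔ P (point s (-5)) :=
    iff_of_baseNext_special hs hP (j := 9) (baseNext_point_vortexX_add_two 2)
  have hX : ∀ x : ZMod 3, P (vortexX s x) ↔ P (vortexA s) := by
    intro x
    obtain rfl | rfl | rfl := zmod_three_eq x <;> grind only
  have hB : P (vortexB s) ↔ P (vortexA s) := by grind only
  simp only [List.forall_mem_cons]
  refine ⟨⟨?_, ?_, ?_, ?_, ?_, ?_, ?_, ?_, by simp⟩, hB, fun x => hX _⟩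
  · change P (point s 6) ↔ _; grind only
  · change P (point s (-1)) ↔ _; grind only
  · change P (point s 3) ↔ _; grind only
  · change P (point s 0) ↔ _; grind only
  · change P (point s 4) ↔ _; grind only
  · change P (point s 1) ↔ _; grind only
  · change P (point s 5) ↔ _; grind only
  · change P (point s (-2)) ↔ _; grind only

theorem iff_vortexA_neg_one (hs : 2 ≤ s)
    (hP : ∀ v, v ≠ special s 5 → (P v ↔ P (modNext s (special s 5) v))) (v : Vertex s)
    (hv : v ≠ special s 5) : P v ↔ P (vortexA s) := by
  refine iff_of_links hs (-1) hP (fun f1 f2 f3 f4 => ?_) v hv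
  replace f1 : P (point s 7) ↔ P (point s 3) := f1
  replace f2 : P (point s 2) ↔ P (vortexX s 0) := f2
  replace f3 : P (point s (-8)) ↔ P (point s (-4)) := f3
  replace f4 : P (point s (-5)) ↔ P (vortexX s 2) := f4
  have g0 : P (point s 3) ↔ P (point s 0) :=
    iff_of_baseNext_point hs hP (baseNext_point_add_four hs (-1))
  have g1 : P (point s (-4)) ↔ P (point s (-5)) :=
    iff_of_baseNext_point hs hP (baseNext_point_sub_three hs (-1))
  have g2 : P (point s 0) ↔ P (point s (-2)) := iff_of_nextIn hs hP (j := 0) (k := 3) rfl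
  have g3 : P (vortexA s) ↔ P (point s 1) := iff_of_nextIn hs hP (j := 6) (k := 1) rfl
  have g4 : P (point s (-2)) ↔ P (point s 2) :=
    iff_of_baseNext_point hs hP (baseNext_point_sub_one hs (-1))
  have g5 : P (point s 1) ↔ P (vortexB s) :=
    iff_of_baseNext_point hs hP (baseNext_point_add_two hs (-1))
  have g6 : P (vortexB s) ↔ P (point s (-3)) :=
    iff_of_baseNext_special hs hP (j := 7) (baseNext_point_vortexB (-1))
  have g7 : P (point s (-3)) ↔ P (vortexX s 1) :=
    iff_of_baseNext_point hs hP (baseNext_point_sub_two hs (-1))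
  have g8 : P (vortexX s 2) ↔ P (point s 7) :=
    iff_of_baseNext_special hs hP (j := 10) (baseNext_point_vortexX (-1))
  have g9 : P (vortexX s 0) ↔ P (vortexA s) := iff_of_nextIn hs hP (j := 8) (k := 6) rfl
  have g10 : P (vortexX s 1) ↔ P (point s (-8)) :=
    iff_of_baseNext_special hs hP (j := 9) (baseNext_point_vortexX_add_two (-1))
  have hX : ∀ x : ZMod 3, P (vortexX s x) ↔ P (vortexA s) := by
    intro x
    obtain rfl | rfl | rfl := zmod_three_eq x <;> grind only
  have hB : P (vortexB s) ↔ P (vortexA s) := by grind only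
  simp only [List.forall_mem_cons]
  refine ⟨⟨?_, ?_, ?_, ?_, ?_, ?_, ?_, ?_, by simp⟩, hB, fun x => hX _⟩
  · change P (point s 3) ↔ _; grind only
  · change P (point s (-4)) ↔ _; grind only
  · change P (point s 0) ↔ _; grind only
  · change P (point s (-3)) ↔ _; grind only
  · change P (point s 1) ↔ _; grind only
  · change P (point s (-2)) ↔ _; grind only
  · change P (point s 2) ↔ _; grind only
  · change P (point s (-5)) ↔ _; grind only

end Rows

end CurrentGraph

namespace CurrentGraph

variable {s : ℕ} {P : Vertex s → Prop}

/-! ### The untouched rows, the rows of the vortices, and cyclicity everywhere. -/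

section Cyclic

/-- In offsets from `n`, the untouched row is `1, A, -1, 3 … -8, X (n + 1), 2, B, -2, X (n + 2), -7
… -3, -4 … 7, X n, 8 … 4`. -/
theorem iff_vortexA_of_ne_special (hs : 2 ≤ s) (n : ℤ) (hn : ∀ i, special s i ≠ point s n)
    (hP : ∀ v, v ≠ point s n → (P v ↔ P (modNext s (point s n) v))) (v : Vertex s)
    (hv : v ≠ point s n) : P v ↔ P (vortexA s) := by
  have hb : ∀ {v x : Vertex s}, v ≠ point s n → baseNext s (point s n) v = x → (P v ↔ P x) := by
    rintro v _ hv rfl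
    rw [hP v hv, modNext_eq_baseNext fun i j hi => absurd hi (hn i)]
  have hne : ∀ k : ℤ, k ≠ 0 → |k| < 27 → point s (n + k) ≠ point s n := by
    intro k h1 h2 e
    have := point_injOn (s := s) (by rw [add_sub_cancel_left]; omega) e
    omega
  refine iff_of_links hs n hP (fun f1 f2 f3 f4 => ?_) v hv
  have g0 := hb (hne 4 (by norm_num) (by norm_num)) (baseNext_point_add_four hs n)
  have g1 := hb (hne (-3) (by norm_num) (by norm_num)) (baseNext_point_sub_three hs n)
  have g2 := hb (hne 1 (by norm_num) (by norm_num)) (baseNext_point_add_one n)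
  have g3 := hb (v := vortexA s) Sum.inr_ne_inl (baseNext_point_vortexA n)
  have g4 := hb (hne (-1) (by norm_num) (by norm_num)) (baseNext_point_sub_one hs n)
  have g5 := hb (hne 2 (by norm_num) (by norm_num)) (baseNext_point_add_two hs n)
  have g6 := hb (v := vortexB s) Sum.inr_ne_inl (baseNext_point_vortexB n)
  have g7 := hb (hne (-2) (by norm_num) (by norm_num)) (baseNext_point_sub_two hs n)
  have g8 := hb (v := vortexX s n) Sum.inr_ne_inl (baseNext_point_vortexX n)
  have g9 := hb (v := vortexX s (n + 1)) Sum.inr_ne_inl (baseNext_point_vortexX_add_one n)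
  have g10 := hb (v := vortexX s (n + 2)) Sum.inr_ne_inl (baseNext_point_vortexX_add_two n)
  simp only [sub_eq_add_neg] at f1 f2 f3 f4 g0 g1 g2 g3 g4 g5 g6 g7 g8 g9 g10
  simp only [List.forall_mem_cons]
  refine ⟨⟨?_, ?_, ?_, ?_, ?_, ?_, ?_, ?_, by simp⟩, ?_, fun x => ?_⟩
  iterate 9 grind only
  obtain rfl | rfl | rfl := zmod_three_eq x
  · rw [add_zero]; grind only
  · grind only
  · grind only

theorem iff_vortexA (hs : 2 ≤ s) (n : ℤ)
    (hP : ∀ v, v ≠ point s n → (P v ↔ P (modNext s (point s n) v))) (v : Vertex s)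
    (hv : v ≠ point s n) : P v ↔ P (vortexA s) := by
  by_cases h : ∃ i, special s i = point s n
  · obtain ⟨i, hi⟩ := h
    have hi6 : i < 6 := isLeft_special.1 (by rw [hi]; rfl)
    rw [← hi] at hP hv
    obtain rfl | rfl | rfl | rfl | rfl | rfl :
        i = 0 ∨ i = 1 ∨ i = 2 ∨ i = 3 ∨ i = 4 ∨ i = 5 := by omega
    · exact iff_vortexA_zero hs hP v hv
    · exact iff_vortexA_one hs hP v hv
    · exact iff_vortexA_four hs hP v hv
    · exact iff_vortexA_neg_two hs hP v hv
    · exact iff_vortexA_two hs hP v hv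
    · exact iff_vortexA_neg_one hs hP v hv
  · exact iff_vortexA_of_ne_special hs n (not_exists.1 h) hP v hv

/-- At a vortex, the successors in the base embedding stay linked if the changed ones do. -/
theorem iff_baseNext_vortex (hs : 2 ≤ s) {i : Fin 11} (hi : 6 ≤ i)
    (hP : ∀ v, v ≠ special s i → (P v ↔ P (modNext s (special s i) v)))
    (h : ∀ j < 6, nextIn newCorners i j ≠ none →
      (P (special s j) ↔ P (baseNext s (special s i) (special s j)))) (n : ℤ) :
    P (point s n) ↔ P (baseNext s (special s i) (point s n)) := by
  by_cases hn : ∃ j, special s j = point s n ∧ nextIn newCorners i j ≠ none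
  · obtain ⟨j, hj, hne⟩ := hn
    rw [← hj]
    exact h j (isLeft_special.1 (by rw [hj]; rfl)) hne
  · push Not at hn
    have hne : point s n ≠ special s i := by
      intro e
      exact absurd (isLeft_special.1 (by rw [← e]; rfl)) (not_lt.2 hi)
    rw [hP _ hne, modNext_eq_baseNext]
    intro i' j hi' hj
    rw [special_injective hs hi']
    exact hn j hj

/-- In the base row of `A` the successor of `n` is `n + 1`. The stretch `-2, -1, 0, 1, 2` becomes
`-2, 0, 1, -1, X 0, X 2, X 1, B, 2`; its ends and points stay linked, so invariance under the shift
by one is recovered. -/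
theorem iff_two_vortexA (hs : 2 ≤ s)
    (hP : ∀ v, v ≠ special s 6 → (P v ↔ P (modNext s (special s 6) v))) (v : Vertex s)
    (hv : v ≠ special s 6) : P v ↔ P (point s 2) := by
  have e := @iff_of_nextIn s P hs 6 hP
  have hA : ∀ n : ℤ, baseNext s (special s 6) (point s n) = point s (n + 1) := fun n =>
    congrArg Sum.inl (by push_cast; ring)
  have e1 : P (point s (-2)) ↔ P (point s 0) := e (j := 3) (k := 0) rfl
  have e2 : P (point s (-1)) ↔ P (vortexX s 0) := e (j := 5) (k := 8) rfl
  have e3 : P (vortexX s 0) ↔ P (vortexX s 2) := e (j := 8) (k := 10) rfl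
  have e4 : P (vortexX s 2) ↔ P (vortexX s 1) := e (j := 10) (k := 9) rfl
  have e5 : P (vortexX s 1) ↔ P (vortexB s) := e (j := 9) (k := 7) rfl
  have e6 : P (vortexB s) ↔ P (point s 2) := e (j := 7) (k := 4) rfl
  have e7 : P (point s 1) ↔ P (point s (-1)) := e (j := 1) (k := 5) rfl
  have e8 : P (point s 0) ↔ P (point s 1) := iff_of_baseNext_point hs hP (hA 0)
  have hstep : ∀ n : ℤ, P (point s n) ↔ P (point s (n + 1)) := by
    intro n
    rw [← hA]
    refine iff_baseNext_vortex hs le_rfl hP (fun j hj hne => ?_) n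
    obtain rfl | rfl | rfl : j = 3 ∨ j = 5 ∨ j = 1 := by revert j; decide +kernel
    · exact (show P (point s (-2)) ↔ P (point s (-1)) by grind only).trans
        (iff_of_eq (congrArg P ((congrArg (point s) (by norm_num)).trans (hA (-2)).symm)))
    · exact (show P (point s (-1)) ↔ P (point s 0) by grind only).trans
        (iff_of_eq (congrArg P ((congrArg (point s) (by norm_num)).trans (hA (-1)).symm)))
    · exact (show P (point s 1) ↔ P (point s 2) by grind only).trans
        (iff_of_eq (congrArg P ((congrArg (point s) (by norm_num)).trans (hA 1).symm)))
  rcases v with v | (_ | _) | x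
  · obtain ⟨n, hn⟩ := exists_point_eq v
    rw [← hn, iff_add_mul (p := fun n => P (point s n)) hstep n (2 - n), one_mul, add_sub_cancel]
  · exact absurd rfl hv
  · exact e6
  · change P (vortexX s x) ↔ _
    obtain rfl | rfl | rfl := zmod_three_eq x <;> grind only

/-- The base row of `B` is the shift by two, which is transitive because the group has odd order.
The steps from `-2` to `0` and from `2` to `4` now pass through `X 2` and through `A, X 1, X 0`. -/
theorem iff_two_vortexB (hs : 2 ≤ s)
    (hP : ∀ v, v ≠ special s 7 → (P v ↔ P (modNext s (special s 7) v))) (v : Vertex s)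
    (hv : v ≠ special s 7) : P v ↔ P (point s 2) := by
  have e := @iff_of_nextIn s P hs 7 hP
  have hB : ∀ n : ℤ, baseNext s (special s 7) (point s n) = point s (n + 2) := fun n =>
    congrArg Sum.inl (by push_cast; ring)
  have e1 : P (point s (-2)) ↔ P (vortexX s 2) := e (j := 3) (k := 10) rfl
  have e2 : P (vortexX s 2) ↔ P (point s 0) := e (j := 10) (k := 0) rfl
  have e3 : P (point s 2) ↔ P (vortexA s) := e (j := 4) (k := 6) rfl
  have e4 : P (vortexA s) ↔ P (vortexX s 1) := e (j := 6) (k := 9) rfl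
  have e5 : P (vortexX s 1) ↔ P (vortexX s 0) := e (j := 9) (k := 8) rfl
  have e6 : P (vortexX s 0) ↔ P (point s 4) := e (j := 8) (k := 2) rfl
  have hstep : ∀ n : ℤ, P (point s n) ↔ P (point s (n + 2)) := by
    intro n
    rw [← hB]
    refine iff_baseNext_vortex hs (by decide) hP (fun j hj hne => ?_) n
    obtain rfl | rfl : j = 3 ∨ j = 4 := by revert j; decide +kernel
    · exact (show P (point s (-2)) ↔ P (point s 0) by grind only).trans
        (iff_of_eq (congrArg P ((congrArg (point s) (by norm_num)).trans (hB (-2)).symm)))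
    · exact (show P (point s 2) ↔ P (point s 4) by grind only).trans
        (iff_of_eq (congrArg P ((congrArg (point s) (by norm_num)).trans (hB 2).symm)))
  have h2 : ∀ n : ℤ, P (point s n) ↔ P (point s 2) := by
    intro n
    -- `6 * s + 2` is the inverse of `2` modulo `12 * s + 3`.
    have hm : point s n = point s (2 - 2 * ((6 * s + 2) * (2 - n))) := by
      refine congrArg Sum.inl ?_
      push_cast
      linear_combination (2 - n) * quarter s * modulus_eq_zero s
    rw [hm, iff_add_mul (p := fun n => P (point s n)) hstep _ ((6 * s + 2) * (2 - n)),
      sub_add_cancel]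
  rcases v with v | (_ | _) | x
  · obtain ⟨n, hn⟩ := exists_point_eq v
    rw [← hn, h2]
  · exact e3.symm
  · exact absurd rfl hv
  · change P (vortexX s x) ↔ _
    have := h2 0
    obtain rfl | rfl | rfl := zmod_three_eq x <;> grind only

theorem baseNext_vortexX_point (n : ℤ) :
    baseNext s (vortexX s n) (point s n) = point s (n + 7) :=
  (if_pos (residue_mul_quarter n).symm).trans (congrArg Sum.inl (by push_cast; ring))

theorem baseNext_vortexX_add_one_point (n : ℤ) :
    baseNext s (vortexX s (n + 1)) (point s n) = point s (n - 8) := by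
  have := vortexX_add_one_baseNext (s := s) (n * quarter s)
  rw [residue_mul_quarter] at this
  exact this.trans (congrArg Sum.inl (by push_cast; ring))

theorem baseNext_vortexX_add_two_point (n : ℤ) :
    baseNext s (vortexX s (n + 2)) (point s n) = point s (n - 2) := by
  have := vortexX_add_two_baseNext (s := s) (n * quarter s)
  rw [residue_mul_quarter] at this
  exact this.trans (congrArg Sum.inl (by push_cast; ring))

/-- The base row of `X i` runs through the residue classes modulo `3` by steps `+7`, `-2`, `-8`.
Three steps shift by `-3`, so every class is exhausted. -/
theorem iff_point_of_baseNext_vortexX (i : ℤ)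
    (h : ∀ n, P (point s n) ↔ P (baseNext s (vortexX s i) (point s n))) (n : ℤ) :
    P (point s n) ↔ P (point s i) := by
  have h3 : (3 : ZMod 3) = 0 := rfl
  have hadd : ∀ k : ℤ, vortexX s ((i + 3 * k : ℤ) : ZMod 3) = vortexX s i := by
    intro k
    push_cast
    rw [h3, zero_mul, add_zero]
  have h1 : ∀ k : ℤ, P (point s (i + 3 * k)) ↔ P (point s (i + 3 * k + 7)) := by
    intro k
    rw [h, ← hadd k, baseNext_vortexX_point]
  have h2 : ∀ k : ℤ, P (point s (i + 3 * k + 7)) ↔ P (point s (i + 3 * k + 5)) := by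
    intro k
    have := baseNext_vortexX_add_two_point (s := s) (i + 3 * k + 7)
    rw [show (((i + 3 * k + 7 : ℤ) : ZMod 3) + 2) = ((i + 3 * (k + 3) : ℤ) : ZMod 3) by
      push_cast; ring, hadd] at this
    rw [h, this]
    ring_nf
  have h4 : ∀ k : ℤ, P (point s (i + 3 * k + 5)) ↔ P (point s (i + 3 * k - 3)) := by
    intro k
    have := baseNext_vortexX_add_one_point (s := s) (i + 3 * k + 5)
    rw [show (((i + 3 * k + 5 : ℤ) : ZMod 3) + 1) = ((i + 3 * (k + 2) : ℤ) : ZMod 3) by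
      push_cast; ring, hadd] at this
    rw [h, this]
    ring_nf
  have h5 : ∀ k : ℤ, P (point s (i + 3 * k)) ↔ P (point s i) := by
    intro k
    rw [iff_add_mul (p := fun k => P (point s (i + 3 * k))) (d := -1) (fun k => ?_) k k]
    · ring_nf
    · rw [h1, h2, h4]
      ring_nf
  obtain ⟨k, hk | hk | hk⟩ : ∃ k, n = i + 3 * k ∨ n = i + 3 * k + 7 ∨ n = i + 3 * k + 5 := by
    refine ⟨(n - i) / 3 - if (n - i) % 3 = 0 then 0 else if (n - i) % 3 = 1 then 2 else 1, ?_⟩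
    split_ifs <;> omega
  · rw [hk, h5]
  · rw [hk, ← h1, h5]
  · rw [hk, ← h2, ← h1, h5]

/-- The base steps from `4` to `2` and from `1` to `-1` are rerouted through `B, X 1` and `X 2, A`.
For `X 1` and `X 2` below, a single base step takes in all four other vortices. -/
theorem iff_vortexX_zero (hs : 2 ≤ s)
    (hP : ∀ v, v ≠ special s 8 → (P v ↔ P (modNext s (special s 8) v))) (v : Vertex s)
    (hv : v ≠ special s 8) : P v ↔ P (point s 0) := by
  have e := @iff_of_nextIn s P hs 8 hP
  have e1 : P (point s 4) ↔ P (vortexB s) := e (j := 2) (k := 7) rfl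
  have e2 : P (vortexB s) ↔ P (vortexX s 1) := e (j := 7) (k := 9) rfl
  have e3 : P (vortexX s 1) ↔ P (point s 2) := e (j := 9) (k := 4) rfl
  have e4 : P (point s 1) ↔ P (vortexX s 2) := e (j := 1) (k := 10) rfl
  have e5 : P (vortexX s 2) ↔ P (vortexA s) := e (j := 10) (k := 6) rfl
  have e6 : P (vortexA s) ↔ P (point s (-1)) := e (j := 6) (k := 5) rfl
  have h := iff_point_of_baseNext_vortexX 0 (iff_baseNext_vortex hs (i := 8) (by decide) hP
    fun j hj hne => by
      obtain rfl | rfl : j = 1 ∨ j = 2 := by revert j; decide +kernel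
      · exact (show P (point s 1) ↔ P (point s (-1)) by grind only).trans
          (iff_of_eq (congrArg P (baseNext_vortexX_add_two_point 1).symm))
      · exact (show P (point s 4) ↔ P (point s 2) by grind only).trans
          (iff_of_eq (congrArg P (baseNext_vortexX_add_two_point 4).symm)))
  have h2 := h 2
  have h1 := h (-1)
  rcases v with v | (_ | _) | x
  · obtain ⟨n, hn⟩ := exists_point_eq v
    rw [← hn, h]
  · change P (vortexA s) ↔ _
    grind only
  · change P (vortexB s) ↔ _
    grind only
  · change P (vortexX s x) ↔ _
    obtain rfl | rfl | rfl := zmod_three_eq x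
    · exact absurd rfl hv
    · grind only
    · grind only

theorem iff_vortexX_one (hs : 2 ≤ s)
    (hP : ∀ v, v ≠ special s 9 → (P v ↔ P (modNext s (special s 9) v))) (v : Vertex s)
    (hv : v ≠ special s 9) : P v ↔ P (point s 1) := by
  have e := @iff_of_nextIn s P hs 9 hP
  have e1 : P (point s 2) ↔ P (vortexX s 0) := e (j := 4) (k := 8) rfl
  have e2 : P (vortexX s 0) ↔ P (vortexB s) := e (j := 8) (k := 7) rfl
  have e3 : P (vortexB s) ↔ P (vortexA s) := e (j := 7) (k := 6) rfl
  have e4 : P (vortexA s) ↔ P (vortexX s 2) := e (j := 6) (k := 10) rfl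
  have e5 : P (vortexX s 2) ↔ P (point s 0) := e (j := 10) (k := 0) rfl
  have h := iff_point_of_baseNext_vortexX 1 (iff_baseNext_vortex hs (i := 9) (by decide) hP
    fun j hj hne => by
      obtain rfl : j = 4 := by revert j; decide +kernel
      exact (show P (point s 2) ↔ P (point s 0) by grind only).trans
        (iff_of_eq (congrArg P (baseNext_vortexX_add_two_point 2).symm)))
  have h0 := h 0
  rcases v with v | (_ | _) | x
  · obtain ⟨n, hn⟩ := exists_point_eq v
    rw [← hn, h]
  · change P (vortexA s) ↔ _
    grind only
  · change P (vortexB s) ↔ _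
    grind only
  · change P (vortexX s x) ↔ _
    obtain rfl | rfl | rfl := zmod_three_eq x
    · grind only
    · exact absurd rfl hv
    · grind only

theorem iff_vortexX_two (hs : 2 ≤ s)
    (hP : ∀ v, v ≠ special s 10 → (P v ↔ P (modNext s (special s 10) v))) (v : Vertex s)
    (hv : v ≠ special s 10) : P v ↔ P (point s 2) := by
  have e := @iff_of_nextIn s P hs 10 hP
  have e1 : P (point s 0) ↔ P (vortexX s 1) := e (j := 0) (k := 9) rfl
  have e2 : P (vortexX s 1) ↔ P (vortexA s) := e (j := 9) (k := 6) rfl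
  have e3 : P (vortexA s) ↔ P (vortexX s 0) := e (j := 6) (k := 8) rfl
  have e4 : P (vortexX s 0) ↔ P (vortexB s) := e (j := 8) (k := 7) rfl
  have e5 : P (vortexB s) ↔ P (point s (-2)) := e (j := 7) (k := 3) rfl
  have h := iff_point_of_baseNext_vortexX 2 (iff_baseNext_vortex hs (i := 10) (by decide) hP
    fun j hj hne => by
      obtain rfl : j = 0 := by revert j; decide +kernel
      exact (show P (point s 0) ↔ P (point s (-2)) by grind only).trans
        (iff_of_eq (congrArg P (baseNext_vortexX_add_two_point 0).symm)))
  have h0 := h 0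
  rcases v with v | (_ | _) | x
  · obtain ⟨n, hn⟩ := exists_point_eq v
    rw [← hn, h]
  · change P (vortexA s) ↔ _
    grind only
  · change P (vortexB s) ↔ _
    grind only
  · change P (vortexX s x) ↔ _
    obtain rfl | rfl | rfl := zmod_three_eq x
    · grind only
    · grind only
    · exact absurd rfl hv

theorem modNext_cyclic (hs : 2 ≤ s) (u : Vertex s) (P : Vertex s → Prop)
    (hP : ∀ v, v ≠ u → (P v ↔ P (modNext s u v))) (v w : Vertex s) (hv : v ≠ u) (hw : w ≠ u) :
    P v ↔ P w := by
  suffices ∃ b : Prop, ∀ v, v ≠ u → (P v ↔ b) by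
    obtain ⟨b, hb⟩ := this
    rw [hb v hv, hb w hw]
  rcases u with u | y
  · obtain ⟨n, hn⟩ := exists_point_eq u
    rw [← hn] at hP ⊢
    exact ⟨_, iff_vortexA hs n hP⟩
  · obtain ⟨i, hi6, hi⟩ := exists_special_eq_inr (s := s) y
    rw [← hi] at hP ⊢
    obtain rfl | rfl | rfl | rfl | rfl : i = 6 ∨ i = 7 ∨ i = 8 ∨ i = 9 ∨ i = 10 := by omega
    · exact ⟨_, iff_two_vortexA hs hP⟩
    · exact ⟨_, iff_two_vortexB hs hP⟩
    · exact ⟨_, iff_vortexX_zero hs hP⟩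
    · exact ⟨_, iff_vortexX_one hs hP⟩
    · exact ⟨_, iff_vortexX_two hs hP⟩

theorem isPentagonalRotation_modNext (hs : 2 ≤ s) :
    IsPentagonalRotation (modNext s) (pentagon s) where
  ne := modNext_ne hs
  cyclic := modNext_cyclic hs
  triangle := modNext_triangle hs
  closed := modNext_closed hs
  pentagon l := modNext_special hs (nextIn_pentagon l)
  injective := (special_injective hs).comp pentagonLabel_injective

end Cyclic

end CurrentGraph

/-! ### Conclusion for all `s ≥ 1`. -/

theorem exists_isPentagonalRotation (s : ℕ) (hs : 1 ≤ s) :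
    ∃ (nxt : Fin (12 * s + 8) → Fin (12 * s + 8) → Fin (12 * s + 8))
      (p : ZMod 5 → Fin (12 * s + 8)), IsPentagonalRotation nxt p := by
  obtain rfl | hs : s = 1 ∨ 2 ≤ s := by omega
  · exact ⟨_, _, isPentagonalRotation_nextTwenty⟩
  · have e : CurrentGraph.Vertex s ≃ Fin (12 * s + 8) := by
      refine Fintype.equivFinOfCardEq ?_
      simp [CurrentGraph.Vertex, ZMod.card]
    exact ⟨_, _, (CurrentGraph.isPentagonalRotation_modNext hs).transport e⟩

theorem mainTheorem4 (s : ℕ) (hs : 1 ≤ s) :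
    ∃ R : RotationSystem (SimpleGraph.completeGraph (Fin (12 * s + 8))),
      R.IsMinimumGenus ∧ R.IsNearlyTriangular ∧ R.IsOfSingleType 5 := by
  obtain ⟨nxt, p, h⟩ := exists_isPentagonalRotation s hs
  exact ⟨h.rotationSystem, h.rotationSystem.isMinimumGenus_of_singleType h.isOfSingleType,
    RotationSystem.isNearlyTriangular_of_singleType h.isOfSingleType, h.isOfSingleType⟩
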